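/- **Theorem (demand learning with stochastic values).** A seller and a buyer play $T\ge 2$ rounds. In round $t$ the seller posts a price $p_t\in[0,1]$, and the buyer, who sees $p_t$, the past of the game and the current value $v_t$, decides whether to buy ($a_t=1$) or not ($a_t=0$). The values $v_1,\dots,v_T$ are i.i.d. from a distribution $\mathcal D$ on $[0,1]$ that is unknown to the seller, who observes only the prices and decisions. Let $d(p)=\Pr_{v\sim\mathcal D}(v\ge p)$, $p\in\mathbb R$, be the demand curve and $f(p)=p\,d(p)$ the revenue curve. Assume that $d$ is $L$-Lipschitz on $\mathbb R$, that $f$ attains its maximum over $[0,1]$ at a unique point $p^\star$, that $p^\star\in(0,1)$, and that $f$ is twice differentiable at $p^\star$ with $f''(p^\star)<0$. Then there are constants $C_1,C_2>0$ with $$C_1(p^\star-p)^2\le f(p^\star)-f(p)\le C_2(p^\star-p)^2\qquad\text{for all }p\in[0,1];$$ fix any such constants. Let $0<\gamma<1$ and $T_\gamma=\frac1{1-\gamma}$. The seller runs SUCCESSIVEELIMINATIONDELAYED on the arms (prices) $i/K$, $1\le i\le K$, where a round with price $p_t$ has reward $r_t=p_ta_t$, with $$K=\Big\lceil (T/\log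 T)^{1/4}\Big\rceil,\qquad D=\big\lceil T_\gamma\log(LT_\gamma T)\big\rceil,\qquad \delta=L\varepsilon,\quad \varepsilon=\frac1{LT}.$$ That is, the policy keeps a set $S$ of arms, initially all of them, and proceeds in phases until round $T$ has been played. A phase pulls each arm of $S$ once, in increasing order. If $t$ is the next round after the phase, then, with $n_i=\max\{\#\{\tau\le t-D:\ i_\tau=i\},1\}$ and $\hat\mu_i=\frac1{n_i}\sum_{\tau\le t-D,\ i_\tau=i}r_\tau$ (where $i_\tau$ is the arm pulled in round $\tau$), it sets $\mathrm{LCB}_i=\hat\mu_i-\sqrt{2\log(T)/n_i}-\delta$ and $\mathrm{UCB}_i=\hat\mu_i+\sqrt{2\log(T)/n_i}+\delta$, and it replaces $S$ by $\{i\in S:\ \mathrm{UCB}_i\ge\mathrm{LCB}_j\text{ for all }j\in S\}$. The buyer is $\gamma$-discounting: knowing $\mathcal D$ and the seller's policy, it uses a (possibly randomized) policy that maximizes $\mathbb E\big[\sum_{t=1}^T\gamma^ta_t(v_t-p_t)\big]$. Then, for every such buyer policy, the seller's Stackelberg regret satisfies $$T\max_{p\in[0,1]}p\,d(p)-\mathbb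 E\Big[\sum_{t=1}^Tp_ta_t\Big]\ \le\ C\Big((C_2+C_1^{-1})\sqrt{T\log T}+T_\gamma\log^2(LT_\gamma T)\Big),$$ where $C$ is an absolute constant. -/

import Mathlib

open MeasureTheory Set Filter Topology
open scoped NNReal

noncomputable section

/-! ### The bandit policy: successive elimination with delayed feedback -/

/-- State of the policy between two rounds: the set of surviving arms, the arms of the current
phase that are still to be pulled (in order), and the observed pairs `(arm, reward)`, oldest
first. -/
structure SEState (α : Type*) where
  active : Finset α
  queue : List α
  history : List (α × ℝ)

section Bandit

variable {α : Type*} [LinearOrder α]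

/-- `n = max {number of pulls of arm i in h, 1}`. -/
def pullCount (h : List (α × ℝ)) (i : α) : ℕ :=
  max (h.countP (fun x => decide (x.1 = i))) 1

/-- Empirical mean reward of arm `i` in `h`. -/
def empiricalMean (h : List (α × ℝ)) (i : α) : ℝ :=
  ((h.filter (fun x => decide (x.1 = i))).map Prod.snd).sum / (pullCount h i : ℝ)

def lowerConfidenceBound (T : ℕ) (δ : ℝ) (h : List (α × ℝ)) (i : α) : ℝ :=
  empiricalMean h i - Real.sqrt (2 * Real.log T / (pullCount h i : ℝ)) - δ

def upperConfidenceBound (T : ℕ) (δ : ℝ) (h : List (α × ℝ)) (i : α) : ℝ :=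
  empiricalMean h i + Real.sqrt (2 * Real.log T / (pullCount h i : ℝ)) + δ

open Classical in
/-- The arms of `S` whose upper confidence bound is at least the lower confidence bound of every
arm of `S`, the bounds being computed from the feedback `h`. -/
def eliminateArms (T : ℕ) (δ : ℝ) (h : List (α × ℝ)) (S : Finset α) : Finset α :=
  S.filter (fun i => ∀ j ∈ S, lowerConfidenceBound T δ h j ≤ upperConfidenceBound T δ h i)

/-- All arms survive, and the first phase pulls them in increasing order. -/
def SEState.init (arms : Finset α) : SEState α where
  active := arms
  queue := arms.sort (· ≤ ·)
  history := []

/-- Record the outcome `x` of a round. If this round was the last one of its phase, the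
confidence bounds are computed from the rounds `1, …, t - D`, where `t` is the next round, arms
are eliminated, and a new phase starts that pulls each surviving arm once. -/
def SEState.step (T D : ℕ) (δ : ℝ) (s : SEState α) (x : α × ℝ) : SEState α :=
  let h := s.history ++ [x]
  match s.queue.tail with
  | [] =>
    let S := eliminateArms T δ (h.take (h.length + 1 - D)) s.active
    { active := S, queue := S.sort (· ≤ ·), history := h }
  | i :: q => { active := s.active, queue := i :: q, history := h }

/-- The arm that successive elimination with delay `D`, error bound `δ` and horizon `T` pulls
after the history `h` of pairs `(arm, reward)`. -/
def successiveEliminationDelayed [Inhabited α] (arms : Finset α) (T D : ℕ) (δ : ℝ)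
    (h : List (α × ℝ)) : α :=
  (h.foldl (SEState.step T D δ) (SEState.init arms)).queue.headI

end Bandit

/-! ### Demand and revenue -/

/-- The demand curve `d(p) = Pr_{v ∼ 𝒟}(v ≥ p)`. -/
def demand (𝒟 : Measure ℝ) (p : ℝ) : ℝ := 𝒟.real (Ici p)

/-- The expected revenue `f(p) = p d(p)` of price `p` against a myopic buyer. -/
def revenue (𝒟 : Measure ℝ) (p : ℝ) : ℝ := p * demand 𝒟 p

/-- `C₁ (p* - p)² ≤ f(p*) - f(p) ≤ C₂ (p* - p)²` for all prices `p ∈ [0,1]`, with positive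
constants. -/
def QuadraticGap (𝒟 : Measure ℝ) (pstar C₁ C₂ : ℝ) : Prop :=
  0 < C₁ ∧ 0 < C₂ ∧ ∀ p ∈ Icc (0 : ℝ) 1,
    C₁ * (pstar - p) ^ 2 ≤ revenue 𝒟 pstar - revenue 𝒟 p ∧
      revenue 𝒟 pstar - revenue 𝒟 p ≤ C₂ * (pstar - p) ^ 2

/-! ### The repeated posted-price game -/

/-- The buyer's decision as a number: `1` for buying, `0` for not buying. -/
def purchase (a : Bool) : ℝ := if a then 1 else 0

/-- A (deterministic) seller policy maps the public history of pairs `(price, decision)`, oldest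
first, to the next price. -/
abbrev SellerPolicy := List (ℝ × Bool) → ℝ

/-- A buyer policy. The decision may depend on a private random seed, on everything the buyer has
seen in the previous rounds, namely the list of triples `(price, value, decision)`, oldest first,
and on the current price and the current value (in this order). -/
structure BuyerPolicy (Ξ : Type*) [MeasurableSpace Ξ] where
  act : Ξ → List (ℝ × ℝ × Bool) → ℝ → ℝ → Bool
  measurable_act : ∀ n : ℕ, Measurable
    (fun q : Ξ × (Fin n → ℝ × ℝ × Bool) × ℝ × ℝ =>
      act q.1 (List.ofFn q.2.1) q.2.2.1 q.2.2.2)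

/-- The part of the buyer's history that the seller observes. -/
def publicHistory (h : List (ℝ × ℝ × Bool)) : List (ℝ × Bool) :=
  h.map (fun x => (x.1, x.2.2))

section Game

variable {Ξ : Type*} [MeasurableSpace Ξ]

/-- The first `t` rounds of the game, for the seed `ξ` and the sequence `v` of values
(round number `t + 1` has value `v t`). -/
def play (A : SellerPolicy) (B : BuyerPolicy Ξ) (ξ : Ξ) (v : ℕ → ℝ) :
    ℕ → List (ℝ × ℝ × Bool)
  | 0 => []
  | t + 1 =>
    let h := play A B ξ v t
    let p := A (publicHistory h)
    h ++ [(p, v t, B.act ξ h p (v t))]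

/-- The price posted in round number `t + 1`. -/
def priceAt (A : SellerPolicy) (B : BuyerPolicy Ξ) (ξ : Ξ) (v : ℕ → ℝ) (t : ℕ) : ℝ :=
  A (publicHistory (play A B ξ v t))

/-- The buyer's decision in round number `t + 1`. -/
def decisionAt (A : SellerPolicy) (B : BuyerPolicy Ξ) (ξ : Ξ) (v : ℕ → ℝ) (t : ℕ) : Bool :=
  B.act ξ (play A B ξ v t) (priceAt A B ξ v t) (v t)

/-- The joint law of the buyer's seed and of the values, which are i.i.d. with law `𝒟` and
independent of the seed. -/
def gameLaw (ρ : Measure Ξ) (𝒟 : Measure ℝ) : Measure (Ξ × (ℕ → ℝ)) :=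
  ρ.prod (Measure.infinitePi (fun _ : ℕ => 𝒟))

/-- The buyer's expected discounted profit `E[∑_{t=1}^T γ^t a_t (v_t - p_t)]`. -/
def buyerUtility (γ : ℝ) (T : ℕ) (ρ : Measure Ξ) (𝒟 : Measure ℝ)
    (A : SellerPolicy) (B : BuyerPolicy Ξ) : ℝ :=
  ∫ ω, ∑ t ∈ Finset.range T,
    γ ^ (t + 1) * (purchase (decisionAt A B ω.1 ω.2 t) * (ω.2 t - priceAt A B ω.1 ω.2 t))
    ∂(gameLaw ρ 𝒟)

/-- `B` is a policy of a `γ`-discounting buyer facing the seller policy `A`: it maximizes the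
expected discounted profit. -/
def IsDiscountingBuyer (γ : ℝ) (T : ℕ) (ρ : Measure Ξ) (𝒟 : Measure ℝ)
    (A : SellerPolicy) (B : BuyerPolicy Ξ) : Prop :=
  ∀ B' : BuyerPolicy Ξ, buyerUtility γ T ρ 𝒟 A B' ≤ buyerUtility γ T ρ 𝒟 A B

/-- The seller's Stackelberg regret `T max_p p d(p) - E[∑_{t=1}^T p_t a_t]`. -/
def sellerRegret (T : ℕ) (ρ : Measure Ξ) (𝒟 : Measure ℝ)
    (A : SellerPolicy) (B : BuyerPolicy Ξ) : ℝ :=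
  (T : ℝ) * sSup (revenue 𝒟 '' Icc (0 : ℝ) 1) -
    ∫ ω, ∑ t ∈ Finset.range T,
      priceAt A B ω.1 ω.2 t * purchase (decisionAt A B ω.1 ω.2 t) ∂(gameLaw ρ 𝒟)

end Game

/-! ### The pricing policy -/

/-- The discretized prices `i / K`, `1 ≤ i ≤ K`. -/
def priceGrid (K : ℕ) : Finset ℝ := (Finset.Icc 1 K).image (fun i : ℕ => (i : ℝ) / (K : ℝ))

/-- Successive elimination on the discretized pricing problem: the arms are the prices `i / K`,
and the reward of a round with price `p` and decision `a` is `p a`. -/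
def eliminationPricing (K T D : ℕ) (δ : ℝ) : SellerPolicy := fun H =>
  successiveEliminationDelayed (priceGrid K) T D δ
    (H.map (fun x => (x.1, x.1 * purchase x.2)))

end

/-! The proof has a strategic half and a statistical half, joined by the delay `D`.

Strategic half. A decision cannot influence a price fewer than `D` rounds later. Deviating in one
round therefore puts at risk only the discounted surplus from then on, which relative to the current
round is worth less than `γ ^ D / (1 - γ) ≤ ε = 1 / (L T)`. An optimal buyer thus almost surely buys
when `v ≥ p + ε` and refuses when `v ≤ p - ε` (`IsDiscountingBuyer.ae_myopic`); nothing is claimed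
in between. The decisions are sandwiched between two threshold rules whose demands differ from
`d(p)` by at most `L ε = δ = 1 / T`.

Statistical half. The price of a round is fixed before its value is drawn, so an exponential
supermartingale gives Hoeffding bounds for the values seen at each price, simultaneously for all
prices and all numbers of pulls (`exists_bad_event`). Off an event of probability `O(K / T ^ 3)`
every empirical mean is then within its confidence radius plus `δ` of the revenue curve
(`concentrated_of_sandwich`), and the rest is deterministic.

Under concentration the best arm survives, and an arm of gap `Δ ≥ 8 δ` is pulled `O(log T / Δ ^ 2)`
times, plus the pulls hidden by the delay. The surviving arms share the hidden window evenly, so it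
costs an arm about `D / #active`; in the order of elimination this sums to `D` times a harmonic
number instead of `D K` (`Concentrated.exists_pulls_le`).

On the grid, the quadratic gap turns `∑ log T / Δ` into `K ^ 2 log T / C₁` times a convergent sum of
inverse squares, while discretization costs `C₂ T / K ^ 2` (`Concentrated.sum_gap_le`). The choice
of `K` with `K ^ 4` of order `T / log T` balances the two. -/

noncomputable section

/-! ### Combinatorics of successive elimination: phases, balance of pulls, the delay window -/

section EliminationRun

variable {α : Type*} [LinearOrder α]

lemma eliminateArms_subset (T : ℕ) (δ : ℝ) (h : List (α × ℝ)) (S : Finset α) :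
    eliminateArms T δ h S ⊆ S := by
  unfold eliminateArms
  exact Finset.filter_subset _ _

lemma mem_eliminateArms {T : ℕ} {δ : ℝ} {h : List (α × ℝ)} {S : Finset α} {i : α} :
    i ∈ eliminateArms T δ h S ↔
      i ∈ S ∧ ∀ j ∈ S, lowerConfidenceBound T δ h j ≤ upperConfidenceBound T δ h i := by
  unfold eliminateArms
  exact Finset.mem_filter

/-- The arm with the largest upper bound survives: for `δ ≥ 0` no lower bound exceeds the upper
bound of its own arm. -/
lemma eliminateArms_nonempty (T : ℕ) {δ : ℝ} (hδ : 0 ≤ δ) (h : List (α × ℝ)) {S : Finset α}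
    (hS : S.Nonempty) : (eliminateArms T δ h S).Nonempty := by
  obtain ⟨i, hi, hmax⟩ := S.exists_max_image (upperConfidenceBound T δ h) hS
  refine ⟨i, mem_eliminateArms.2 ⟨hi, fun j hj => le_trans ?_ (hmax j hj)⟩⟩
  unfold lowerConfidenceBound upperConfidenceBound
  have := Real.sqrt_nonneg (2 * Real.log T / (pullCount h j : ℝ))
  linarith

variable [Inhabited α]

/-- The state of successive elimination before round `t + 1`, when pulling arm `i` in round `s + 1`
yields the reward `R s i`. -/
def eliminationRun (arms : Finset α) (T D : ℕ) (δ : ℝ) (R : ℕ → α → ℝ) : ℕ → SEState α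
  | 0 => SEState.init arms
  | t + 1 =>
    let s := eliminationRun arms T D δ R t
    s.step T D δ (s.queue.headI, R t s.queue.headI)

variable (arms : Finset α) (T D : ℕ) (δ : ℝ) (R : ℕ → α → ℝ)

/-- The arm pulled in round `t + 1`. -/
def pulledArm (t : ℕ) : α := (eliminationRun arms T D δ R t).queue.headI

/-- The arms and rewards of the first `m` rounds. -/
def pullHistory (m : ℕ) : List (α × ℝ) :=
  (List.range m).map fun s => (pulledArm arms T D δ R s, R s (pulledArm arms T D δ R s))

/-- The number of pulls of arm `i` in the first `m` rounds. -/
def pulls (i : α) (m : ℕ) : ℕ := {s ∈ Finset.range m | pulledArm arms T D δ R s = i}.card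

@[simp]
lemma length_pullHistory (m : ℕ) : (pullHistory arms T D δ R m).length = m := by
  simp [pullHistory]

lemma pullHistory_succ (m : ℕ) : pullHistory arms T D δ R (m + 1) =
    pullHistory arms T D δ R m ++ [(pulledArm arms T D δ R m, R m (pulledArm arms T D δ R m))] := by
  simp [pullHistory, List.range_succ]

lemma take_pullHistory {k m : ℕ} (h : k ≤ m) :
    (pullHistory arms T D δ R m).take k = pullHistory arms T D δ R k := by
  simp [pullHistory, ← List.map_take, List.take_range, min_eq_left h]

lemma pulls_succ (i : α) (m : ℕ) : pulls arms T D δ R i (m + 1) =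
    pulls arms T D δ R i m + if pulledArm arms T D δ R m = i then 1 else 0 := by
  unfold pulls
  rw [Finset.range_add_one, Finset.filter_insert]
  split_ifs with h
  · rw [Finset.card_insert_of_notMem (by simp)]
  · rfl

@[simp]
lemma pulls_zero (i : α) : pulls arms T D δ R i 0 = 0 := by simp [pulls]

lemma countP_pullHistory (i : α) (m : ℕ) :
    (pullHistory arms T D δ R m).countP (fun x => decide (x.1 = i)) = pulls arms T D δ R i m := by
  induction m with
  | zero => simp [pullHistory]
  | succ m ih =>
    rw [pullHistory_succ, List.countP_append, ih, pulls_succ]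
    simp [List.countP_cons]

lemma pullCount_pullHistory (i : α) (m : ℕ) :
    pullCount (pullHistory arms T D δ R m) i = max (pulls arms T D δ R i m) 1 := by
  rw [pullCount, countP_pullHistory]

lemma eliminationRun_history (t : ℕ) :
    (eliminationRun arms T D δ R t).history = pullHistory arms T D δ R t := by
  induction t with
  | zero => simp [eliminationRun, SEState.init, pullHistory]
  | succ t ih =>
    rw [pullHistory_succ, ← ih, eliminationRun]
    simp only [SEState.step]
    split <;> rfl

/-- Round `t + 1` closes its phase, so the next round is `t + 2` and the feedback consists of the
first `t + 2 - D` rounds, none if `D` is larger. Since `1 ≤ D`, this is a prefix of the recorded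
history. -/
lemma eliminationRun_succ_of_tail_eq_nil (hD : 1 ≤ D) {t : ℕ}
    (h : (eliminationRun arms T D δ R t).queue.tail = []) :
    (eliminationRun arms T D δ R (t + 1)).active =
        eliminateArms T δ (pullHistory arms T D δ R (t + 2 - D))
          (eliminationRun arms T D δ R t).active ∧
      (eliminationRun arms T D δ R (t + 1)).queue =
        (eliminationRun arms T D δ R (t + 1)).active.sort (· ≤ ·) := by
  have hh : (eliminationRun arms T D δ R t).history ++
      [((eliminationRun arms T D δ R t).queue.headI,
        R t (eliminationRun arms T D δ R t).queue.headI)] = pullHistory arms T D δ R (t + 1) := by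
    rw [pullHistory_succ, eliminationRun_history]; rfl
  rw [eliminationRun]
  simp only [SEState.step, hh, length_pullHistory, h]
  rw [take_pullHistory _ _ _ _ _ (by omega)]
  exact ⟨rfl, trivial⟩

lemma eliminationRun_succ_of_tail_ne_nil {t : ℕ}
    (h : (eliminationRun arms T D δ R t).queue.tail ≠ []) :
    (eliminationRun arms T D δ R (t + 1)).active = (eliminationRun arms T D δ R t).active ∧
      (eliminationRun arms T D δ R (t + 1)).queue =
        (eliminationRun arms T D δ R t).queue.tail := by
  rw [eliminationRun]
  simp only [SEState.step]
  split
  · contradiction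
  · rename_i heq
    exact ⟨rfl, heq.symm⟩

/-- The invariant of the run. A nonempty queue means that `headI` never returns its default value;
being a suffix of the sorted active set makes the queue duplicate-free and its head active. -/
lemma eliminationRun_queue (hD : 1 ≤ D) (hδ : 0 ≤ δ) (harms : arms.Nonempty) (t : ℕ) :
    (eliminationRun arms T D δ R t).active.Nonempty ∧
      (eliminationRun arms T D δ R t).queue ≠ [] ∧
      (eliminationRun arms T D δ R t).queue <:+
        (eliminationRun arms T D δ R t).active.sort (· ≤ ·) := by
  have key (S : Finset α) (hS : S.Nonempty) : S.sort (· ≤ ·) ≠ [] := fun h => by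
    obtain ⟨i, hi⟩ := hS
    rw [← Finset.mem_sort (· ≤ ·), h] at hi
    simp at hi
  induction t with
  | zero => exact ⟨harms, key _ harms, List.suffix_rfl⟩
  | succ t ih =>
    by_cases h : (eliminationRun arms T D δ R t).queue.tail = []
    · obtain ⟨h1, h2⟩ := eliminationRun_succ_of_tail_eq_nil arms T D δ R hD h
      have h3 := eliminateArms_nonempty T hδ (pullHistory arms T D δ R (t + 2 - D)) ih.1
      rw [← h1] at h3
      exact ⟨h3, by rw [h2]; exact key _ h3, by rw [h2]⟩
    · obtain ⟨h1, h2⟩ := eliminationRun_succ_of_tail_ne_nil arms T D δ R h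
      rw [h1, h2]
      exact ⟨ih.1, h, (List.tail_suffix _).trans ih.2.2⟩

lemma eliminationRun_active_antitone (hD : 1 ≤ D) :
    Antitone fun t => (eliminationRun arms T D δ R t).active := by
  refine antitone_nat_of_succ_le fun t => ?_
  by_cases h : (eliminationRun arms T D δ R t).queue.tail = []
  · rw [(eliminationRun_succ_of_tail_eq_nil arms T D δ R hD h).1]
    exact eliminateArms_subset _ _ _ _
  · rw [(eliminationRun_succ_of_tail_ne_nil arms T D δ R h).1]

lemma pulledArm_mem_active (hD : 1 ≤ D) (hδ : 0 ≤ δ) (harms : arms.Nonempty) (t : ℕ) :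
    pulledArm arms T D δ R t ∈ (eliminationRun arms T D δ R t).active := by
  obtain ⟨-, h2, h3⟩ := eliminationRun_queue arms T D δ R hD hδ harms t
  rw [← Finset.mem_sort (· ≤ ·)]
  refine h3.subset ?_
  unfold pulledArm
  cases hq : (eliminationRun arms T D δ R t).queue with
  | nil => exact absurd hq h2
  | cons i q => simp

lemma pulledArm_mem (hD : 1 ≤ D) (hδ : 0 ≤ δ) (harms : arms.Nonempty) (t : ℕ) :
    pulledArm arms T D δ R t ∈ arms :=
  eliminationRun_active_antitone arms T D δ R hD (Nat.zero_le t)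
    (pulledArm_mem_active arms T D δ R hD hδ harms t)

/-- All arms that are active before round `t + 1` have been pulled equally often before the current
phase, which starts after `s` rounds, and at most once since then; unless it is the first phase, no
confidence bounds of active arms are separated at its start. -/
lemma exists_phase_start (hD : 1 ≤ D) (hδ : 0 ≤ δ) (harms : arms.Nonempty) (t : ℕ) :
    ∃ s ≤ t, ∃ m : ℕ,
      (eliminationRun arms T D δ R s).active = (eliminationRun arms T D δ R t).active ∧
      (∀ i ∈ (eliminationRun arms T D δ R t).active, pulls arms T D δ R i s = m ∧
        pulls arms T D δ R i t =
          m + if i ∈ (eliminationRun arms T D δ R t).queue then 0 else 1) ∧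
      (s = 0 ∨ ∀ i ∈ (eliminationRun arms T D δ R t).active,
        ∀ j ∈ (eliminationRun arms T D δ R t).active,
          lowerConfidenceBound T δ (pullHistory arms T D δ R (s + 1 - D)) j ≤
            upperConfidenceBound T δ (pullHistory arms T D δ R (s + 1 - D)) i) := by
  induction t with
  | zero =>
    refine ⟨0, le_rfl, 0, rfl, fun i hi => ⟨by simp, ?_⟩, Or.inl rfl⟩
    have : i ∈ (eliminationRun arms T D δ R 0).queue := (Finset.mem_sort (· ≤ ·)).2 hi
    simp [this]
  | succ t ih =>
    obtain ⟨s, hst, m, h1, h2, h3⟩ := ih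
    obtain ⟨-, hne, hsuff⟩ := eliminationRun_queue arms T D δ R hD hδ harms t
    have hnodup : (eliminationRun arms T D δ R t).queue.Nodup :=
      hsuff.sublist.nodup (Finset.sort_nodup _ _)
    have hpa : pulledArm arms T D δ R t = (eliminationRun arms T D δ R t).queue.headI := rfl
    have hcons : (eliminationRun arms T D δ R t).queue =
        pulledArm arms T D δ R t :: (eliminationRun arms T D δ R t).queue.tail := by
      rw [hpa]
      cases hq : (eliminationRun arms T D δ R t).queue with
      | nil => exact absurd hq hne
      | cons i q => rfl
    by_cases h : (eliminationRun arms T D δ R t).queue.tail = []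
    · obtain ⟨ha, hq⟩ := eliminationRun_succ_of_tail_eq_nil arms T D δ R hD h
      rw [h] at hcons
      refine ⟨t + 1, le_rfl, m + 1, rfl, fun i hi => ?_, Or.inr fun i hi j hj => ?_⟩
      · have hi' : i ∈ (eliminationRun arms T D δ R (t + 1)).queue := by
          rw [hq]; exact (Finset.mem_sort (· ≤ ·)).2 hi
        have hit := (h2 i (eliminationRun_active_antitone arms T D δ R hD (Nat.le_succ t) hi)).2
        rw [hcons] at hit
        have : pulls arms T D δ R i (t + 1) = m + 1 := by
          rw [pulls_succ, hit]
          by_cases hia : i = pulledArm arms T D δ R t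
          · simp [hia]
          · simp [hia, Ne.symm hia]
        simp [this, hi']
      · rw [ha] at hi hj
        exact (mem_eliminateArms.1 hi).2 j (mem_eliminateArms.1 hj).1
    · obtain ⟨ha, hq⟩ := eliminationRun_succ_of_tail_ne_nil arms T D δ R h
      rw [ha, hq]
      refine ⟨s, by omega, m, h1, fun i hi => ⟨(h2 i hi).1, ?_⟩, h3⟩
      rw [pulls_succ, (h2 i hi).2]
      rw [hcons] at hnodup ⊢
      have hnot := (List.nodup_cons.1 hnodup).1
      by_cases hia : i = pulledArm arms T D δ R t
      · simp [hia, hnot]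
      · by_cases hiq : i ∈ (eliminationRun arms T D δ R t).queue.tail <;>
          simp [hia, Ne.symm hia, hiq]

lemma pulls_le_pulls_add_one (hD : 1 ≤ D) (hδ : 0 ≤ δ) (harms : arms.Nonempty) {t : ℕ} {i j : α}
    (hi : i ∈ (eliminationRun arms T D δ R t).active)
    (hj : j ∈ (eliminationRun arms T D δ R t).active) :
    pulls arms T D δ R i t ≤ pulls arms T D δ R j t + 1 := by
  obtain ⟨s, -, m, -, h, -⟩ := exists_phase_start arms T D δ R hD hδ harms t
  rw [(h i hi).2, (h j hj).2]
  split_ifs <;> omega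

lemma sum_pulls_window (S : Finset α) {k s : ℕ} (hks : k ≤ s) :
    ∑ j ∈ S, (pulls arms T D δ R j s : ℝ) - ∑ j ∈ S, (pulls arms T D δ R j k : ℝ) ≤
      (s : ℝ) - k := by
  induction s, hks using Nat.le_induction with
  | base => simp
  | succ s hs ih =>
    have : ∑ j ∈ S, (pulls arms T D δ R j (s + 1) : ℝ) ≤
        ∑ j ∈ S, (pulls arms T D δ R j s : ℝ) + 1 := by
      simp only [pulls_succ, Nat.cast_add, Finset.sum_add_distrib]
      gcongr
      push_cast
      rw [Finset.sum_ite_eq]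
      split_ifs <;> norm_num
    push_cast
    linarith

/-- The number of pulls of an active arm in a window of rounds. -/
lemma card_active_mul_window (hD : 1 ≤ D) (hδ : 0 ≤ δ) (harms : arms.Nonempty) {k s : ℕ}
    (hks : k ≤ s) {i : α} (hi : i ∈ (eliminationRun arms T D δ R s).active) :
    ((eliminationRun arms T D δ R s).active.card : ℝ) *
      ((pulls arms T D δ R i s : ℝ) - pulls arms T D δ R i k - 2) ≤ (s : ℝ) - k := by
  refine le_trans ?_ (sum_pulls_window arms T D δ R (eliminationRun arms T D δ R s).active hks)
  rw [← Finset.sum_sub_distrib, ← nsmul_eq_mul]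
  -- Active arms are balanced up to one pull at both ends of the window, so each of them gains at
  -- least as many pulls as `i`, minus 2.
  refine Finset.card_nsmul_le_sum _ _ _ fun j hj => ?_
  have hanti := eliminationRun_active_antitone arms T D δ R hD hks
  have h1 := pulls_le_pulls_add_one arms T D δ R hD hδ harms hi hj
  have h2 := pulls_le_pulls_add_one arms T D δ R hD hδ harms (hanti hj) (hanti hi)
  have h1' : (pulls arms T D δ R i s : ℝ) ≤ pulls arms T D δ R j s + 1 := by exact_mod_cast h1
  have h2' : (pulls arms T D δ R j k : ℝ) ≤ pulls arms T D δ R i k + 1 := by exact_mod_cast h2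
  linarith

end EliminationRun

/-! ### Pull counts when the empirical means concentrate -/

section Regret

variable {α : Type*} [LinearOrder α] [Inhabited α]
variable (arms : Finset α) (T D : ℕ) (δ : ℝ) (R : ℕ → α → ℝ)

/-- At all times the empirical means are within the confidence radius of `μ`. -/
def Concentrated (μ : α → ℝ) : Prop :=
  ∀ m ≤ T, ∀ i ∈ arms, |empiricalMean (pullHistory arms T D δ R m) i - μ i| ≤
    Real.sqrt (2 * Real.log T / (pullCount (pullHistory arms T D δ R m) i : ℝ)) + δ

variable {arms T D δ R}

/-- The true means lie inside their confidence intervals, so the upper bound of `b` is at least `μ b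
≥ μ j`, which is at least the lower bound of `j`. -/
lemma Concentrated.mem_active {μ : α → ℝ} (hc : Concentrated arms T D δ R μ) (hD : 1 ≤ D) {b : α}
    (hb : b ∈ arms) (hmax : ∀ i ∈ arms, μ i ≤ μ b) {t : ℕ} (ht : t ≤ T) :
    b ∈ (eliminationRun arms T D δ R t).active := by
  induction t with
  | zero => exact hb
  | succ t ih =>
    have ih := ih (by omega)
    by_cases h : (eliminationRun arms T D δ R t).queue.tail = []
    · rw [(eliminationRun_succ_of_tail_eq_nil arms T D δ R hD h).1, mem_eliminateArms]
      refine ⟨ih, fun j hj => ?_⟩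
      have hj' : j ∈ arms := eliminationRun_active_antitone arms T D δ R hD (Nat.zero_le t) hj
      have h1 := abs_le.1 (hc (t + 2 - D) (by omega) b hb)
      have h2 := abs_le.1 (hc (t + 2 - D) (by omega) j hj')
      have h3 := hmax j hj'
      unfold lowerConfidenceBound upperConfidenceBound
      linarith [h1.1, h2.2]
    · rwa [(eliminationRun_succ_of_tail_ne_nil arms T D δ R h).1]

/-- An active arm with a large gap has been pulled rarely. -/
lemma Concentrated.pulls_le {μ : α → ℝ} (hc : Concentrated arms T D δ R μ) (hD : 1 ≤ D)
    (hδ : 0 ≤ δ) (hT : 1 ≤ T) {b i : α}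
    (hb : b ∈ arms) (hmax : ∀ i ∈ arms, μ i ≤ μ b) {t : ℕ} (ht : t ≤ T)
    (hi : i ∈ (eliminationRun arms T D δ R t).active) (hpos : μ i < μ b)
    (hgap : 8 * δ ≤ μ b - μ i) :
    (pulls arms T D δ R i t : ℝ) ≤ 200 * Real.log T / (μ b - μ i) ^ 2 +
      D / (eliminationRun arms T D δ R t).active.card + 3 := by
  have harms : arms.Nonempty := ⟨b, hb⟩
  have hlog : 0 ≤ Real.log T := Real.log_nonneg (by exact_mod_cast hT)
  obtain ⟨s, hst, m, h1, h2, h3⟩ := exists_phase_start arms T D δ R hD hδ harms t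
  have hbt := hc.mem_active hD hb hmax ht
  have hit : (pulls arms T D δ R i t : ℝ) ≤ pulls arms T D δ R i s + 1 := by
    obtain ⟨e1, e2⟩ := h2 i hi
    rw [e1, e2]
    split_ifs <;> push_cast <;> linarith
  have hA : 0 ≤ 200 * Real.log T / (μ b - μ i) ^ 2 := by positivity
  have hB : 0 ≤ (D : ℝ) / (eliminationRun arms T D δ R t).active.card := by positivity
  -- In the first phase an arm has been pulled at most once.
  rcases h3 with rfl | h3
  · simp only [pulls_zero, Nat.cast_zero] at hit
    linarith
  -- `k` counts the rounds whose feedback was used when the current phase started; the rounds from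
  -- `k` to `s` are hidden by the delay.
  set k := s + 1 - D with hk
  have hks : k ≤ s := by omega
  have hkD : (s : ℝ) - k ≤ D := by
    have : s ≤ D + k := by omega
    have : (s : ℝ) ≤ D + k := by exact_mod_cast this
    linarith
  rw [← h1] at hi hbt
  have hwin := card_active_mul_window arms T D δ R hD hδ harms hks hi
  have hcard : (0 : ℝ) < (eliminationRun arms T D δ R s).active.card := by
    exact_mod_cast Finset.card_pos.2 ⟨i, hi⟩
  have hwin' : (pulls arms T D δ R i s : ℝ) - pulls arms T D δ R i k - 2 ≤
      D / (eliminationRun arms T D δ R s).active.card := by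
    rw [le_div_iff₀ hcard]
    linarith
  have hanti := eliminationRun_active_antitone arms T D δ R hD hks
  have hib := pulls_le_pulls_add_one arms T D δ R hD hδ harms (hanti hi) (hanti hbt)
  have hi' : i ∈ arms := eliminationRun_active_antitone arms T D δ R hD (Nat.zero_le s) hi
  have c1 := abs_le.1 (hc k (by omega) b hb)
  have c2 := abs_le.1 (hc k (by omega) i hi')
  have hsep := h3 i (h1 ▸ hi) b (h1 ▸ hbt)
  unfold lowerConfidenceBound upperConfidenceBound at hsep
  have hni : (pulls arms T D δ R i k : ℝ) ≤ pullCount (pullHistory arms T D δ R k) i := by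
    rw [pullCount_pullHistory]
    exact_mod_cast le_max_left _ _
  set ni : ℝ := ((pullCount (pullHistory arms T D δ R k) i : ℕ) : ℝ) with hnidef
  set nb : ℝ := ((pullCount (pullHistory arms T D δ R k) b : ℕ) : ℝ) with hnbdef
  have hni1 : 1 ≤ ni := by
    rw [hnidef, pullCount_pullHistory]
    exact_mod_cast le_max_right _ _
  have hnb : ni ≤ 2 * nb := by
    rw [hnidef, hnbdef, pullCount_pullHistory, pullCount_pullHistory]
    norm_cast
    omega
  -- From `ni ≤ 2 * nb`, the radius of `b` exceeds that of `i` by a factor of at most `√2 ≤ 3 / 2`.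
  have hw : Real.sqrt (2 * Real.log T / nb) ≤ 3 / 2 * Real.sqrt (2 * Real.log T / ni) := by
    rw [Real.sqrt_le_left (by positivity), mul_pow, Real.sq_sqrt (by positivity),
      div_le_iff₀ (by linarith)]
    have : 2 * Real.log T / ni * nb ≥ Real.log T := by
      rw [ge_iff_le, div_mul_eq_mul_div, le_div_iff₀ (by linarith)]
      nlinarith
    nlinarith
  -- Overlapping intervals bound the gap by twice both radii plus `4 δ`, hence by `5` radii of `i`
  -- plus half the gap. Squaring `10` radii produces the constant `200`.
  have hgap2 : μ b - μ i ≤ 10 * Real.sqrt (2 * Real.log T / ni) := by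
    linarith [c1.1, c2.2]
  have hsq : (μ b - μ i) ^ 2 ≤ 200 * Real.log T / ni := by
    have := pow_le_pow_left₀ (by linarith) hgap2 2
    rw [mul_pow, Real.sq_sqrt (by positivity)] at this
    refine this.trans (le_of_eq (by ring))
  have hnile : ni ≤ 200 * Real.log T / (μ b - μ i) ^ 2 := by
    have h0 : 0 < (μ b - μ i) ^ 2 := by
      have := sub_pos.2 hpos
      positivity
    rw [le_div_iff₀ h0]
    rw [le_div_iff₀ (by linarith)] at hsq
    linarith
  rw [← h1]
  linarith

end Regret

/-- If the elements of `s` leave one after the other, the reciprocals of the numbers of elements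
that are still there sum to at most a harmonic number. -/
lemma sum_inv_card_filter_le_harmonic {α : Type*} [DecidableEq α] (f : α → ℕ) (s : Finset α) :
    ∑ i ∈ s, ((({j ∈ s | f i ≤ f j}.card : ℕ) : ℝ))⁻¹ ≤ (harmonic s.card : ℝ) := by
  induction hn : s.card generalizing s with
  | zero => simp [Finset.card_eq_zero.1 hn]
  | succ n ih =>
    have hs : s.Nonempty := Finset.card_pos.1 (by omega)
    -- The element leaving first sees all of `s` and contributes `1 / (n + 1)`; removing it from the
    -- other counts only enlarges their reciprocals.
    obtain ⟨a, ha, hmin⟩ := s.exists_min_image f hs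
    have hcard : (s.erase a).card = n := by rw [Finset.card_erase_of_mem ha]; omega
    rw [← Finset.add_sum_erase s _ ha, harmonic_succ]
    have h1 : {j ∈ s | f a ≤ f j} = s := Finset.filter_true_of_mem hmin
    have h2 := ih _ hcard
    have h3 : ∑ i ∈ s.erase a, ((({j ∈ s | f i ≤ f j}.card : ℕ) : ℝ))⁻¹ ≤
        ∑ i ∈ s.erase a, ((({j ∈ s.erase a | f i ≤ f j}.card : ℕ) : ℝ))⁻¹ := by
      refine Finset.sum_le_sum fun i hi => ?_
      have hpos : 0 < {j ∈ s.erase a | f i ≤ f j}.card :=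
        Finset.card_pos.2 ⟨i, by simpa using Finset.mem_erase.1 hi⟩
      gcongr
      exact Finset.erase_subset _ _
    rw [h1, hn]
    push_cast
    linarith

/-- The total numbers of pulls of successive elimination when the empirical means concentrate. -/
theorem Concentrated.exists_pulls_le {α : Type*} [LinearOrder α] [Inhabited α] {arms : Finset α}
    {T D : ℕ} {δ : ℝ} {R : ℕ → α → ℝ} {μ : α → ℝ} (hc : Concentrated arms T D δ R μ) (hD : 1 ≤ D)
    (hδ : 0 ≤ δ) (hT : 1 ≤ T) {b : α} (hb : b ∈ arms) (hmax : ∀ i ∈ arms, μ i ≤ μ b) :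
    ∃ u : α → ℝ, (∀ i, 0 ≤ u i) ∧ ∑ i ∈ arms, u i ≤ (harmonic arms.card : ℝ) ∧
      ∀ i ∈ arms, μ i < μ b → 8 * δ ≤ μ b - μ i →
        (pulls arms T D δ R i T : ℝ) ≤ 200 * Real.log T / (μ b - μ i) ^ 2 + D * u i + 4 := by
  classical
  set act := fun t => (eliminationRun arms T D δ R t).active with hact
  have hanti : Antitone act := eliminationRun_active_antitone arms T D δ R hD
  -- The last time at which the arm is active. The active set at time `f i` contains every `j` with
  -- `f i ≤ f j`, which bounds the delay cost of `i` by `D` times the reciprocal of their number.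
  set f : α → ℕ := fun i => Nat.findGreatest (fun t => i ∈ act t) T with hf
  have hfle (i : α) : f i ≤ T := Nat.findGreatest_le T
  have hfmem {i : α} (hi : i ∈ arms) : i ∈ act (f i) :=
    Nat.findGreatest_spec (P := fun t => i ∈ act t) (Nat.zero_le T) hi
  refine ⟨fun i => ((({j ∈ arms | f i ≤ f j}.card : ℕ) : ℝ))⁻¹, fun i => by positivity,
    sum_inv_card_filter_le_harmonic f arms, fun i hi hpos hgap => ?_⟩
  have h1 := hc.pulls_le hD hδ hT hb hmax (hfle i) (hfmem hi) hpos hgap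
  -- Only active arms are pulled, so beyond the first `f i` rounds there is at most the pull of
  -- round `f i + 1`.
  have h2 : pulls arms T D δ R i T ≤ pulls arms T D δ R i (f i + 1) := by
    refine Finset.card_le_card fun s hs => ?_
    simp only [Finset.mem_filter, Finset.mem_range] at hs ⊢
    refine ⟨Nat.lt_succ_of_le (Nat.le_findGreatest (by omega) ?_), hs.2⟩
    rw [← hs.2]
    exact pulledArm_mem_active arms T D δ R hD hδ ⟨b, hb⟩ s
  rw [pulls_succ] at h2
  have h3 : (pulls arms T D δ R i T : ℝ) ≤ pulls arms T D δ R i (f i) + 1 := by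
    have : pulls arms T D δ R i T ≤ pulls arms T D δ R i (f i) + 1 := by
      split_ifs at h2 <;> omega
    exact_mod_cast this
  have h4 : (D : ℝ) / (eliminationRun arms T D δ R (f i)).active.card ≤
      D * ((({j ∈ arms | f i ≤ f j}.card : ℕ) : ℝ))⁻¹ := by
    have hpos : 0 < {j ∈ arms | f i ≤ f j}.card :=
      Finset.card_pos.2 ⟨i, by simpa using hi⟩
    rw [div_eq_mul_inv]
    gcongr
    intro j hj
    rw [Finset.mem_filter] at hj
    exact hanti hj.2 (hfmem hj.1)
  linarith

/-! ### The quadratic gap around the optimal price -/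

/-- Adding a parabola shifts the second derivative, which reduces quadratic bounds near `p` to the
second derivative test. -/
lemma deriv_deriv_add_quadratic {f : ℝ → ℝ} {p : ℝ} (hdiff : ∀ᶠ x in 𝓝 p, DifferentiableAt ℝ f x)
    (hd : DifferentiableAt ℝ (deriv f) p) (c : ℝ) :
    deriv (fun x => f x + c * (x - p) ^ 2) p = deriv f p ∧
      deriv (deriv fun x => f x + c * (x - p) ^ 2) p = deriv (deriv f) p + 2 * c := by
  have h1 : ∀ᶠ x in 𝓝 p, deriv (fun x => f x + c * (x - p) ^ 2) x =
      deriv f x + c * (2 * (x - p)) := by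
    filter_upwards [hdiff] with x hx
    have h2 : HasDerivAt (fun x => c * (x - p) ^ 2) (c * (2 * (x - p))) x := by
      have := (((hasDerivAt_id x).sub_const p).pow 2).const_mul c
      simpa using this
    exact (hx.hasDerivAt.add h2).deriv
  refine ⟨by simpa using h1.self_of_nhds, ?_⟩
  rw [Filter.EventuallyEq.deriv_eq h1]
  have h2 : HasDerivAt (fun x => c * (2 * (x - p))) (c * (2 * 1)) p :=
    (((hasDerivAt_id p).sub_const p).const_mul 2).const_mul c
  exact (hd.hasDerivAt.add h2).deriv.trans (by ring)

/-- A function with a unique interior maximizer on `[0,1]` and negative second derivative there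
has a quadratic gap. -/
theorem exists_quadratic_gap {f : ℝ → ℝ} {p : ℝ} (hf : Continuous f) (hp : p ∈ Ioo (0 : ℝ) 1)
    (hmax : ∀ x ∈ Icc (0 : ℝ) 1, x ≠ p → f x < f p)
    (hdiff : ∀ᶠ x in 𝓝 p, DifferentiableAt ℝ f x) (hd2 : deriv (deriv f) p < 0) :
    ∃ C₁ C₂ : ℝ, 0 < C₁ ∧ 0 < C₂ ∧ ∀ x ∈ Icc (0 : ℝ) 1,
      C₁ * (p - x) ^ 2 ≤ f p - f x ∧ f p - f x ≤ C₂ * (p - x) ^ 2 := by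
  -- A nonzero `deriv` excludes its default value `0`, so `deriv f` really is differentiable at `p`.
  have hd : DifferentiableAt ℝ (deriv f) p := differentiableAt_of_deriv_ne_zero hd2.ne
  have hlocal : IsLocalMax f p := by
    filter_upwards [isOpen_Ioo.mem_nhds hp] with x hx
    rcases eq_or_ne x p with rfl | h
    · exact le_rfl
    · exact (hmax x (Ioo_subset_Icc_self hx) h).le
  have hd1 : deriv f p = 0 := hlocal.deriv_eq_zero
  set e := -deriv (deriv f) p with he
  have hepos : 0 < e := by linarith
  have hcont (c : ℝ) : ContinuousAt (fun x => f x + c * (x - p) ^ 2) p := by fun_prop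
  -- With `f'' = -e`, the coefficient `e / 4` leaves second derivative `-e / 2`, hence a local
  -- maximum, and `e` leaves `e`, hence a local minimum.
  obtain ⟨a1, a2⟩ := deriv_deriv_add_quadratic hdiff hd (e / 4)
  obtain ⟨b1, b2⟩ := deriv_deriv_add_quadratic hdiff hd e
  have hlow : ∀ᶠ x in 𝓝 p, f x + e / 4 * (x - p) ^ 2 ≤ f p := by
    have : IsLocalMax (fun x => f x + e / 4 * (x - p) ^ 2) p :=
      isLocalMax_of_deriv_deriv_neg (by rw [a2]; linarith) (by rw [a1, hd1]) (hcont _)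
    filter_upwards [this] with x hx
    simpa using hx
  have hupp : ∀ᶠ x in 𝓝 p, f p ≤ f x + e * (x - p) ^ 2 := by
    have : IsLocalMin (fun x => f x + e * (x - p) ^ 2) p :=
      isLocalMin_of_deriv_deriv_pos (by rw [b2]; linarith) (by rw [b1, hd1]) (hcont _)
    filter_upwards [this] with x hx
    simpa using hx
  obtain ⟨U, hU, hUo, hpU⟩ := eventually_nhds_iff.1 (hlow.and hupp)
  -- Away from `p` the quotient of gap and squared distance is continuous and positive on a compact
  -- set, possibly empty, so it has positive lower and finite upper bounds.
  have hK : IsCompact (Icc (0 : ℝ) 1 \ U) := isCompact_Icc.diff hUo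
  have hne (x : ℝ) (hx : x ∈ Icc (0 : ℝ) 1 \ U) : x ≠ p := fun h => hx.2 (h ▸ hpU)
  have hsq (x : ℝ) (hx : x ∈ Icc (0 : ℝ) 1 \ U) : 0 < (p - x) ^ 2 := by
    have := sub_ne_zero.2 (hne x hx).symm
    positivity
  have hq : ContinuousOn (fun x => (f p - f x) / (p - x) ^ 2) (Icc (0 : ℝ) 1 \ U) :=
    ContinuousOn.div (by fun_prop) (by fun_prop) fun x hx => (hsq x hx).ne'
  obtain ⟨m, hm, hm'⟩ := hK.exists_forall_le' hq (a := 0) fun x hx =>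
    div_pos (sub_pos.2 (hmax x hx.1 (hne x hx))) (hsq x hx)
  obtain ⟨M, hM⟩ := hK.bddAbove_image hq
  refine ⟨min (e / 4) m, max e M, lt_min (by linarith) hm, lt_max_of_lt_left hepos,
    fun x hx => ?_⟩
  have hs : 0 ≤ (p - x) ^ 2 := sq_nonneg _
  have hsym : (x - p) ^ 2 = (p - x) ^ 2 := by ring
  by_cases hxU : x ∈ U
  · obtain ⟨h1, h2⟩ := hU x hxU
    rw [hsym] at h1 h2
    have h3 := mul_le_mul_of_nonneg_right (min_le_left (e / 4) m) hs
    have h4 := mul_le_mul_of_nonneg_right (le_max_left e M) hs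
    constructor <;> linarith
  · have h1 := hm' x ⟨hx, hxU⟩
    have h2 := hM (mem_image_of_mem _ ⟨hx, hxU⟩)
    rw [le_div_iff₀ (hsq x ⟨hx, hxU⟩)] at h1
    rw [div_le_iff₀ (hsq x ⟨hx, hxU⟩)] at h2
    have h3 := mul_le_mul_of_nonneg_right (min_le_right (e / 4) m) hs
    have h4 := mul_le_mul_of_nonneg_right (le_max_right e M) hs
    constructor <;> linarith

/-! ### Measurability, realizable deviations and resampling of a value -/

section Game

variable {Ξ : Type*} [MeasurableSpace Ξ]

/-- The public history of `t` rounds in which the seller uses `A` and the decisions are `b`. -/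
def decisionHistory (A : SellerPolicy) (b : ℕ → Bool) : ℕ → List (ℝ × Bool)
  | 0 => []
  | t + 1 => decisionHistory A b t ++ [(A (decisionHistory A b t), b t)]

/-- The price posted in round `t + 1` when the decisions are `b`. -/
def decisionPrice (A : SellerPolicy) (b : ℕ → Bool) (t : ℕ) : ℝ := A (decisionHistory A b t)

lemma decisionHistory_congr (A : SellerPolicy) {b b' : ℕ → Bool} {t : ℕ}
    (h : ∀ s < t, b s = b' s) : decisionHistory A b t = decisionHistory A b' t := by
  induction t with
  | zero => rfl
  | succ t ih =>
    rw [decisionHistory, decisionHistory, ih fun s hs => h s (by omega), h t (by omega)]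

lemma publicHistory_play (A : SellerPolicy) (B : BuyerPolicy Ξ) (ξ : Ξ) (v : ℕ → ℝ) (t : ℕ) :
    publicHistory (play A B ξ v t) = decisionHistory A (decisionAt A B ξ v) t := by
  induction t with
  | zero => rfl
  | succ t ih =>
    rw [decisionHistory, ← ih]
    simp only [play, publicHistory, List.map_append, List.map_cons, List.map_nil]
    rfl

lemma priceAt_eq_decisionPrice (A : SellerPolicy) (B : BuyerPolicy Ξ) (ξ : Ξ) (v : ℕ → ℝ) (t : ℕ) :
    priceAt A B ξ v t = decisionPrice A (decisionAt A B ξ v) t := by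
  rw [priceAt, publicHistory_play, decisionPrice]

lemma play_eq_ofFn (A : SellerPolicy) (B : BuyerPolicy Ξ) (ξ : Ξ) (v : ℕ → ℝ) (t : ℕ) :
    play A B ξ v t =
      List.ofFn fun i : Fin t => (priceAt A B ξ v i, v i, decisionAt A B ξ v i) := by
  induction t with
  | zero => rfl
  | succ t ih =>
    rw [List.ofFn_succ', List.concat_eq_append]
    simp only [Fin.val_castSucc, Fin.val_last]
    rw [← ih]
    rfl

lemma length_play (A : SellerPolicy) (B : BuyerPolicy Ξ) (ξ : Ξ) (v : ℕ → ℝ) (t : ℕ) :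
    (play A B ξ v t).length = t := by
  rw [play_eq_ofFn, List.length_ofFn]

lemma play_congr (A : SellerPolicy) (B : BuyerPolicy Ξ) (ξ : Ξ) {v v' : ℕ → ℝ} {t : ℕ}
    (h : ∀ s < t, v s = v' s) : play A B ξ v t = play A B ξ v' t := by
  induction t with
  | zero => rfl
  | succ t ih => simp only [play, ih fun s hs => h s (by omega), h t (by omega)]

lemma priceAt_congr (A : SellerPolicy) (B : BuyerPolicy Ξ) (ξ : Ξ) {v v' : ℕ → ℝ} {t : ℕ}
    (h : ∀ s < t, v s = v' s) : priceAt A B ξ v t = priceAt A B ξ v' t := by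
  rw [priceAt, priceAt, play_congr A B ξ h]

lemma decisionAt_congr (A : SellerPolicy) (B : BuyerPolicy Ξ) (ξ : Ξ) {v v' : ℕ → ℝ} {t : ℕ}
    (h : ∀ s ≤ t, v s = v' s) : decisionAt A B ξ v t = decisionAt A B ξ v' t := by
  have h' : ∀ s < t, v s = v' s := fun s hs => h s hs.le
  rw [decisionAt, decisionAt, play_congr A B ξ h', priceAt_congr A B ξ h', h t le_rfl]

/-- A price depends on finitely many binary decisions only, so it is measurable for an arbitrary
seller policy. -/
lemma measurable_decisionPrice (A : SellerPolicy) {Ω : Type*} [MeasurableSpace Ω]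
    {b : Ω → ℕ → Bool} {t : ℕ} (hb : ∀ s < t, Measurable fun ω => b ω s) :
    Measurable fun ω => decisionPrice A (b ω) t := by
  let G : (Fin t → Bool) → ℝ := fun c =>
    decisionPrice A (fun s => if h : s < t then c ⟨s, h⟩ else false) t
  have hG : (fun ω => decisionPrice A (b ω) t) = G ∘ fun ω (i : Fin t) => b ω i := by
    funext ω
    simp only [G, Function.comp, decisionPrice]
    rw [decisionHistory_congr A]
    intro s hs
    simp [hs]
  rw [hG]
  exact (measurable_of_countable G).comp (measurable_pi_lambda _ fun i => hb i i.2)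

lemma measurable_decisionAt (A : SellerPolicy) (B : BuyerPolicy Ξ) (t : ℕ) :
    Measurable fun ω : Ξ × (ℕ → ℝ) => decisionAt A B ω.1 ω.2 t := by
  induction t using Nat.strong_induction_on with
  | _ t ih =>
    have hp (s : ℕ) (hs : s ≤ t) : Measurable fun ω : Ξ × (ℕ → ℝ) => priceAt A B ω.1 ω.2 s := by
      simp only [priceAt_eq_decisionPrice]
      exact measurable_decisionPrice A fun r hr => ih r (by omega)
    have hv (s : ℕ) : Measurable fun ω : Ξ × (ℕ → ℝ) => ω.2 s :=
      (measurable_pi_apply s).comp measurable_snd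
    have h : Measurable fun ω : Ξ × (ℕ → ℝ) =>
        ((ω.1, fun i : Fin t => (priceAt A B ω.1 ω.2 i, ω.2 i, decisionAt A B ω.1 ω.2 i),
          priceAt A B ω.1 ω.2 t, ω.2 t) : Ξ × (Fin t → ℝ × ℝ × Bool) × ℝ × ℝ) :=
      measurable_fst.prodMk ((measurable_pi_lambda _ fun i : Fin t =>
        (hp i i.2.le).prodMk ((hv i).prodMk (ih i i.2))).prodMk ((hp t le_rfl).prodMk (hv t)))
    have h2 := (B.measurable_act t).comp h
    simp only [Function.comp_def, ← play_eq_ofFn] at h2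
    exact h2

lemma measurable_priceAt (A : SellerPolicy) (B : BuyerPolicy Ξ) (t : ℕ) :
    Measurable fun ω : Ξ × (ℕ → ℝ) => priceAt A B ω.1 ω.2 t := by
  simp only [priceAt_eq_decisionPrice]
  exact measurable_decisionPrice A fun r _ => measurable_decisionAt A B r

/-- Every measurable adapted decision process is realized by a buyer policy. -/
lemma exists_buyerPolicy (A : SellerPolicy) (F : ℕ → Ξ → (ℕ → ℝ) → Bool)
    (hF : ∀ n, Measurable fun ω : Ξ × (ℕ → ℝ) => F n ω.1 ω.2)
    (hadapted : ∀ n ξ v v', (∀ i ≤ n, v i = v' i) → F n ξ v = F n ξ v') :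
    ∃ B : BuyerPolicy Ξ, ∀ ξ v n, decisionAt A B ξ v n = F n ξ v := by
  -- The policy reads the past values off its history. The default `x` of `getD` puts the current
  -- value at index `n`; later indices are irrelevant because `F` is adapted.
  refine ⟨⟨fun ξ h _ x => F h.length ξ fun i => (h.map fun y => y.2.1).getD i x, fun n => ?_⟩,
    fun ξ v n => ?_⟩
  · simp only [List.length_ofFn]
    simp only [List.getD_eq_getElem?_getD]
    refine (hF n).comp (measurable_fst.prodMk (measurable_pi_lambda _ fun i => ?_))
    by_cases hi : i < n
    · simp only [List.getElem?_map, List.getElem?_ofFn, hi, dite_true, Option.map_some]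
      fun_prop
    · simp only [List.getElem?_map, List.getElem?_ofFn, hi, dite_false, Option.map_none]
      fun_prop
  · rw [decisionAt]
    simp only [length_play]
    refine hadapted _ _ _ _ fun i hi => ?_
    rw [play_eq_ofFn, List.getD_eq_getElem?_getD, List.getElem?_map, List.getElem?_ofFn]
    by_cases h : i < n
    · simp [h]
    · obtain rfl : i = n := by omega
      simp

lemma measurable_purchase : Measurable purchase := measurable_of_countable _

lemma purchase_nonneg (a : Bool) : 0 ≤ purchase a := by cases a <;> simp [purchase]

lemma purchase_le_one (a : Bool) : purchase a ≤ 1 := by cases a <;> simp [purchase]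

variable {ρ : Measure Ξ} [IsProbabilityMeasure ρ] {𝒟 : Measure ℝ} [IsProbabilityMeasure 𝒟]

instance : IsProbabilityMeasure (gameLaw ρ 𝒟) := by unfold gameLaw; infer_instance

/-- It suffices to check cylinders: the factor of coordinate `t` comes from the fresh value, all
others from the old sequence. -/
lemma measurePreserving_update (t : ℕ) :
    MeasurePreserving (fun q : (ℕ → ℝ) × ℝ => Function.update q.1 t q.2)
      ((Measure.infinitePi fun _ : ℕ => 𝒟).prod 𝒟) (Measure.infinitePi fun _ : ℕ => 𝒟) := by
  have hm : Measurable fun q : (ℕ → ℝ) × ℝ => Function.update q.1 t q.2 := by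
    refine measurable_pi_lambda _ fun i => ?_
    by_cases h : i = t
    · subst h; simpa using measurable_snd
    · simp only [Function.update_of_ne h]
      exact (measurable_pi_apply i).comp measurable_fst
  refine ⟨hm, Measure.eq_infinitePi _ fun s S hS => ?_⟩
  rw [Measure.map_apply hm (MeasurableSet.pi s.countable_toSet fun i _ => hS i)]
  have hpre : (fun q : (ℕ → ℝ) × ℝ => Function.update q.1 t q.2) ⁻¹' (Set.pi s S) =
      (Set.pi ↑(s.erase t) S) ×ˢ (if t ∈ s then S t else univ) := by
    ext ⟨v, x⟩
    simp only [mem_preimage, Set.mem_pi, mem_prod, Finset.mem_coe, Finset.mem_erase]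
    constructor
    · intro h
      refine ⟨fun i hi => by simpa [Function.update_of_ne hi.1] using h i hi.2, ?_⟩
      split_ifs with ht
      · simpa using h t ht
      · trivial
    · rintro ⟨h1, h2⟩ i hi
      by_cases h : i = t
      · subst h; simpa [hi] using h2
      · simpa [Function.update_of_ne h] using h1 i ⟨h, hi⟩
  rw [hpre, Measure.prod_prod, Measure.infinitePi_pi _ fun i _ => hS i]
  split_ifs with ht
  · exact Finset.prod_erase_mul s (fun i => 𝒟 (S i)) ht
  · rw [Finset.erase_eq_of_notMem ht, measure_univ, mul_one]

/-- Drawing the value of a round anew does not change the law of the game. -/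
lemma measurePreserving_resample (t : ℕ) :
    MeasurePreserving (fun q : (Ξ × (ℕ → ℝ)) × ℝ => (q.1.1, Function.update q.1.2 t q.2))
      ((gameLaw ρ 𝒟).prod 𝒟) (gameLaw ρ 𝒟) := by
  have h1 := (MeasurePreserving.id ρ).prod (measurePreserving_update (𝒟 := 𝒟) t)
  have h2 := measurePreserving_prodAssoc ρ (Measure.infinitePi fun _ : ℕ => 𝒟) 𝒟
  exact h1.comp h2

/-- This replaces conditioning: everything determined before value `t` is drawn is constant in the
inner integral. -/
lemma integral_resample (t : ℕ) {F : Ξ × (ℕ → ℝ) → ℝ} (hF : Integrable F (gameLaw ρ 𝒟)) :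
    ∫ ω, F ω ∂(gameLaw ρ 𝒟) =
      ∫ ω, ∫ x, F (ω.1, Function.update ω.2 t x) ∂𝒟 ∂(gameLaw ρ 𝒟) := by
  have hmp := measurePreserving_resample (ρ := ρ) (𝒟 := 𝒟) t
  have h1 : ∫ ω, F ω ∂(gameLaw ρ 𝒟) =
      ∫ q, F (q.1.1, Function.update q.1.2 t q.2) ∂((gameLaw ρ 𝒟).prod 𝒟) := by
    conv_lhs => rw [← hmp.map_eq]
    rw [integral_map hmp.aemeasurable]
    rw [hmp.map_eq]
    exact hF.aestronglyMeasurable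
  rw [h1]
  exact integral_prod _ (hmp.integrable_comp_of_integrable hF)

lemma ae_value_mem (h : ∀ᵐ v ∂𝒟, v ∈ Icc (0 : ℝ) 1) :
    ∀ᵐ ω ∂(gameLaw ρ 𝒟), ∀ t, ω.2 t ∈ Icc (0 : ℝ) 1 := by
  rw [ae_all_iff]
  intro t
  have h1 : MeasurePreserving (fun ω : Ξ × (ℕ → ℝ) => ω.2 t) (gameLaw ρ 𝒟) 𝒟 :=
    (measurePreserving_eval_infinitePi (fun _ : ℕ => 𝒟) t).comp measurePreserving_snd
  exact h1.quasiMeasurePreserving.ae h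

end Game

/-! ### Delayed reaction of the prices to the decisions -/

section Delay

variable {α : Type*} [LinearOrder α] [Inhabited α]

/-- The first `t` rewards determine the first `t + D` pulls. -/
lemma eliminationRun_congr (arms : Finset α) (T : ℕ) {D : ℕ} (δ : ℝ) (hD : 1 ≤ D)
    {R R' : ℕ → α → ℝ} {t : ℕ} (hR : ∀ s < t, R s = R' s) (s : ℕ) (hs : s < t + D) :
    (eliminationRun arms T D δ R s).active = (eliminationRun arms T D δ R' s).active ∧
      (eliminationRun arms T D δ R s).queue = (eliminationRun arms T D δ R' s).queue := by
  induction s using Nat.strong_induction_on with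
  | _ s ih =>
    cases s with
    | zero => exact ⟨rfl, rfl⟩
    | succ s =>
      obtain ⟨h1, h2⟩ := ih s (by omega) (by omega)
      by_cases h : (eliminationRun arms T D δ R s).queue.tail = []
      · obtain ⟨a1, a2⟩ := eliminationRun_succ_of_tail_eq_nil arms T D δ R hD h
        rw [h2] at h
        obtain ⟨b1, b2⟩ := eliminationRun_succ_of_tail_eq_nil arms T D δ R' hD h
        -- The feedback stops at round `s + 2 - D ≤ t`, where the rewards still agree.
        have hh : pullHistory arms T D δ R (s + 2 - D) = pullHistory arms T D δ R' (s + 2 - D) := by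
          unfold pullHistory
          refine List.map_congr_left fun u hu => ?_
          rw [List.mem_range] at hu
          have : pulledArm arms T D δ R u = pulledArm arms T D δ R' u := by
            rw [pulledArm, pulledArm, (ih u (by omega) (by omega)).2]
          rw [this, hR u (by omega)]
        have : (eliminationRun arms T D δ R (s + 1)).active =
            (eliminationRun arms T D δ R' (s + 1)).active := by rw [a1, b1, hh, h1]
        exact ⟨this, by rw [a2, b2, this]⟩
      · obtain ⟨a1, a2⟩ := eliminationRun_succ_of_tail_ne_nil arms T D δ R h
        rw [h2] at h
        obtain ⟨b1, b2⟩ := eliminationRun_succ_of_tail_ne_nil arms T D δ R' h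
        exact ⟨by rw [a1, b1, h1], by rw [a2, b2, h2]⟩

end Delay

section Pricing

/-- The reward of price `p` in round `s + 1` when the decisions are `b`. -/
def decisionReward (b : ℕ → Bool) (s : ℕ) (p : ℝ) : ℝ := p * purchase (b s)

variable (K T : ℕ) {D : ℕ} {δ : ℝ}

/-- Once the decisions are fixed, the game is a bandit run with prescribed rewards, so the bandit
lemmas apply path by path, however strategic the buyer is. -/
lemma decisionPrice_eliminationPricing (b : ℕ → Bool) (t : ℕ) :
    decisionPrice (eliminationPricing K T D δ) b t =
      pulledArm (priceGrid K) T D δ (decisionReward b) t := by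
  have h (t : ℕ) : ((decisionHistory (eliminationPricing K T D δ) b t).map
      (fun x => (x.1, x.1 * purchase x.2))).foldl (SEState.step T D δ)
        (SEState.init (priceGrid K)) =
      eliminationRun (priceGrid K) T D δ (decisionReward b) t := by
    induction t with
    | zero => rfl
    | succ t ih =>
      rw [decisionHistory, List.map_append, List.foldl_append, ih, eliminationRun]
      simp only [List.map_cons, List.map_nil, List.foldl_cons, List.foldl_nil]
      rw [eliminationPricing, successiveEliminationDelayed, ih]
      rfl
  rw [decisionPrice, eliminationPricing, successiveEliminationDelayed, h, pulledArm]

lemma decisionPrice_congr_of_delay (hD : 1 ≤ D) {b b' : ℕ → Bool} {t s : ℕ}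
    (h : ∀ r < t, b r = b' r) (hs : s < t + D) :
    decisionPrice (eliminationPricing K T D δ) b s =
      decisionPrice (eliminationPricing K T D δ) b' s := by
  rw [decisionPrice_eliminationPricing, decisionPrice_eliminationPricing, pulledArm, pulledArm,
    (eliminationRun_congr (priceGrid K) T δ hD (R := decisionReward b) (R' := decisionReward b')
      (t := t) (fun r hr => by funext p; rw [decisionReward, decisionReward, h r hr]) s hs).2]

lemma priceGrid_nonempty {K : ℕ} (hK : 1 ≤ K) : (priceGrid K).Nonempty :=
  (Finset.nonempty_Icc.2 hK).image _

lemma mem_priceGrid {K : ℕ} {p : ℝ} :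
    p ∈ priceGrid K ↔ ∃ i : ℕ, 1 ≤ i ∧ i ≤ K ∧ (i : ℝ) / K = p := by
  simp [priceGrid, and_assoc]

lemma mem_Icc_of_mem_priceGrid {K : ℕ} {p : ℝ} (hp : p ∈ priceGrid K) : p ∈ Icc (0 : ℝ) 1 := by
  obtain ⟨i, -, hi, rfl⟩ := mem_priceGrid.1 hp
  exact ⟨by positivity, div_le_one_of_le₀ (by exact_mod_cast hi) (by positivity)⟩

lemma decisionPrice_mem_priceGrid {K : ℕ} (hK : 1 ≤ K) (hD : 1 ≤ D) (hδ : 0 ≤ δ) (b : ℕ → Bool)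
    (t : ℕ) : decisionPrice (eliminationPricing K T D δ) b t ∈ priceGrid K := by
  rw [decisionPrice_eliminationPricing]
  exact pulledArm_mem _ _ _ _ _ hD hδ (priceGrid_nonempty hK) t

end Pricing

/-! ### An optimal discounting buyer is nearly myopic -/

section Deviation

variable {Ξ : Type*} [MeasurableSpace Ξ] {ρ : Measure Ξ} [IsProbabilityMeasure ρ]
  {𝒟 : Measure ℝ} [IsProbabilityMeasure 𝒟]

/-- The strict inequality, due to the finite horizon, makes a deviation that gains exactly `ε`
strictly profitable. -/
lemma sum_geometric_tail_lt {γ : ℝ} (h0 : 0 < γ) (h1 : γ < 1) (k T : ℕ) :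
    ∑ s ∈ Finset.range T, (if k ≤ s then γ ^ (s + 1) else 0) < γ ^ (k + 1) / (1 - γ) := by
  have h2 : 0 < 1 - γ := by linarith
  have hpow : (0 : ℝ) < γ ^ (k + 1) := by positivity
  rw [← Finset.sum_filter]
  have : {s ∈ Finset.range T | k ≤ s} = Finset.Ico k T := by
    ext s; simp [and_comm]
  rw [this, Finset.sum_Ico_eq_sum_range]
  have h3 : ∑ j ∈ Finset.range (T - k), γ ^ (k + j + 1) =
      γ ^ (k + 1) * ∑ j ∈ Finset.range (T - k), γ ^ j := by
    rw [Finset.mul_sum]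
    exact Finset.sum_congr rfl fun j _ => by ring
  have h4 : ∑ j ∈ Finset.range (T - k), γ ^ j = (1 - γ ^ (T - k)) / (1 - γ) := by
    rw [geom_sum_eq h1.ne, ← neg_div_neg_eq, neg_sub, neg_sub]
  have h5 : (0 : ℝ) < γ ^ (T - k) := by positivity
  rw [h3, h4, ← mul_div_assoc]
  exact div_lt_div_of_pos_right (mul_lt_of_lt_one_right hpow (by linarith)) h2

/-- The discounted profit of the decisions `b` against `A` when the values are `v`. -/
def discountedProfit (γ : ℝ) (T : ℕ) (A : SellerPolicy) (b : ℕ → Bool) (v : ℕ → ℝ) : ℝ :=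
  ∑ t ∈ Finset.range T, γ ^ (t + 1) * (purchase (b t) * (v t - decisionPrice A b t))

lemma buyerUtility_eq {ρ : Measure Ξ} {𝒟 : Measure ℝ} (γ : ℝ) (T : ℕ)
    (A : SellerPolicy) (B : BuyerPolicy Ξ) :
    buyerUtility γ T ρ 𝒟 A B =
      ∫ ω, discountedProfit γ T A (decisionAt A B ω.1 ω.2) ω.2 ∂(gameLaw ρ 𝒟) := by
  simp only [buyerUtility, discountedProfit, priceAt_eq_decisionPrice]

lemma integrable_discountedProfit {γ : ℝ} (T : ℕ) {A : SellerPolicy}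
    (hprice : ∀ b t, decisionPrice A b t ∈ Icc (0 : ℝ) 1) (B : BuyerPolicy Ξ)
    (hv : ∀ᵐ v ∂𝒟, v ∈ Icc (0 : ℝ) 1) :
    Integrable (fun ω : Ξ × (ℕ → ℝ) => discountedProfit γ T A (decisionAt A B ω.1 ω.2) ω.2)
      (gameLaw ρ 𝒟) := by
  refine integrable_finsetSum _ fun t _ => Integrable.const_mul ?_ _
  refine Integrable.of_bound (C := 1) ?_ ?_
  · refine ((measurable_purchase.comp (measurable_decisionAt A B t)).mul
      (((measurable_pi_apply t).comp measurable_snd).sub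
        (measurable_decisionPrice A fun s _ => measurable_decisionAt A B s))).aestronglyMeasurable
  · filter_upwards [ae_value_mem (ρ := ρ) hv] with ω hω
    have h1 := hω t
    have h2 := hprice (decisionAt A B ω.1 ω.2) t
    rw [norm_mul, Real.norm_eq_abs, Real.norm_eq_abs, abs_of_nonneg (purchase_nonneg _)]
    exact mul_le_one₀ (purchase_le_one _) (abs_nonneg _)
      (abs_le.2 ⟨by linarith [h1.1, h2.2], by linarith [h1.2, h2.1]⟩)

/-- Overriding the decision of a buyer in round `t + 1`, and never buying again, once the seller can
react, if this has changed the decision. -/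
def overrideDecision (t D : ℕ) (c : Bool) (b : ℕ → Bool) (n : ℕ) : Bool :=
  if n = t then c else if n < t + D then b n else b n && (c == b t)

lemma overrideDecision_self (t D : ℕ) (b : ℕ → Bool) : overrideDecision t D (b t) b = b := by
  funext n
  unfold overrideDecision
  split_ifs with h
  · rw [h]
  · rfl
  · simp

/-- The override gains at least `γ ^ (t + 1) * ε` at once and changes nothing while the prices
cannot react. Afterwards the deviating buyer abstains and forgoes at most `1` per round, in total
less than `γ ^ (t + D + 1) / (1 - γ)`, which the gain covers. -/
lemma discountedProfit_lt_override {γ : ℝ} (h0 : 0 < γ) (h1 : γ < 1) {T D t : ℕ} (ht : t < T)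
    (hD : 1 ≤ D) {A : SellerPolicy}
    (hprice : ∀ b t, decisionPrice A b t ∈ Icc (0 : ℝ) 1)
    (hdelay : ∀ b b' : ℕ → Bool, ∀ t s, (∀ r < t, b r = b' r) → s < t + D →
      decisionPrice A b s = decisionPrice A b' s) {ε : ℝ} (hε : γ ^ D / (1 - γ) ≤ ε)
    {b : ℕ → Bool} {c : Bool} {v : ℕ → ℝ} (hv : ∀ t, v t ∈ Icc (0 : ℝ) 1) (hc : c ≠ b t)
    (hgain : ε ≤ (purchase c - purchase (b t)) * (v t - decisionPrice A b t)) :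
    discountedProfit γ T A b v < discountedProfit γ T A (overrideDecision t D c b) v := by
  set b' := overrideDecision t D c b with hb'
  have hlt (s : ℕ) (hs : s < t) : b s = b' s := by
    simp [hb', overrideDecision, hs.ne, Nat.lt_add_right D hs]
  have hp (s : ℕ) (hs : s < t + D) : decisionPrice A b' s = decisionPrice A b s :=
    (hdelay b b' t s hlt hs).symm
  have key (s : ℕ) : (if s = t then γ ^ (t + 1) * ε else 0) -
      (if t + D ≤ s then γ ^ (s + 1) else 0) ≤
      γ ^ (s + 1) * (purchase (b' s) * (v s - decisionPrice A b' s)) -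
        γ ^ (s + 1) * (purchase (b s) * (v s - decisionPrice A b s)) := by
    have hg : (0 : ℝ) < γ ^ (s + 1) := by positivity
    rcases lt_trichotomy s t with h | rfl | h
    · rw [if_neg h.ne, if_neg (by omega), hp s (by omega), ← hlt s h]
      simp
    · have : b' s = c := by simp [hb', overrideDecision]
      rw [if_pos rfl, if_neg (by omega), hp s (by omega), this, ← mul_sub, ← sub_mul, sub_zero]
      exact mul_le_mul_of_nonneg_left hgain hg.le
    · by_cases hs : s < t + D
      · have : b' s = b s := by simp [hb', overrideDecision, h.ne', hs]
        rw [if_neg h.ne', if_neg (by omega), hp s hs, this]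
        simp
      · have : b' s = false := by simp [hb', overrideDecision, h.ne', hs, hc]
        rw [if_neg h.ne', if_pos (by omega), this]
        have h1 := hv s
        have h2 := hprice b s
        have h3 : purchase (b s) * (v s - decisionPrice A b s) ≤ 1 := by
          have := purchase_le_one (b s)
          have := purchase_nonneg (b s)
          nlinarith [h1.1, h1.2, h2.1, h2.2]
        have h4 := mul_le_mul_of_nonneg_left h3 hg.le
        simp only [purchase, Bool.false_eq_true, if_false] at h4 ⊢
        linarith
  have hsum := Finset.sum_le_sum fun s (_ : s ∈ Finset.range T) => key s
  rw [Finset.sum_sub_distrib, Finset.sum_sub_distrib, Finset.sum_ite_eq' (Finset.range T) t,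
    if_pos (Finset.mem_range.2 ht)] at hsum
  have htail := sum_geometric_tail_lt h0 h1 (t + D) T
  have hfin : γ ^ (t + D + 1) / (1 - γ) ≤ γ ^ (t + 1) * ε := by
    calc γ ^ (t + D + 1) / (1 - γ) = γ ^ (t + 1) * (γ ^ D / (1 - γ)) := by ring
      _ ≤ _ := mul_le_mul_of_nonneg_left hε (by positivity)
  unfold discountedProfit
  linarith

/-- A discounting buyer decides myopically if this is clearly profitable compared with the
discounted value of what the seller can react to. -/
theorem IsDiscountingBuyer.ae_myopic {γ : ℝ} (h0 : 0 < γ) (h1 : γ < 1) {T D : ℕ}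
    (hD : 1 ≤ D) {A : SellerPolicy}
    (hprice : ∀ b t, decisionPrice A b t ∈ Icc (0 : ℝ) 1)
    (hdelay : ∀ b b' : ℕ → Bool, ∀ t s, (∀ r < t, b r = b' r) → s < t + D →
      decisionPrice A b s = decisionPrice A b' s) {ε : ℝ} (hε : γ ^ D / (1 - γ) ≤ ε)
    (hv : ∀ᵐ v ∂𝒟, v ∈ Icc (0 : ℝ) 1) {B : BuyerPolicy Ξ}
    (hB : IsDiscountingBuyer γ T ρ 𝒟 A B) {t : ℕ} (ht : t < T) :
    ∀ᵐ ω ∂(gameLaw ρ 𝒟),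
      (priceAt A B ω.1 ω.2 t + ε ≤ ω.2 t → decisionAt A B ω.1 ω.2 t = true) ∧
      (ω.2 t ≤ priceAt A B ω.1 ω.2 t - ε → decisionAt A B ω.1 ω.2 t = false) := by
  have hεpos : 0 < ε := lt_of_lt_of_le (div_pos (by positivity) (by linarith)) hε
  -- The decision of `B`, corrected only where the value is at least `ε` away from the price.
  let c : Ξ → (ℕ → ℝ) → Bool := fun ξ v =>
    if priceAt A B ξ v t + ε ≤ v t then true
    else if v t ≤ priceAt A B ξ v t - ε then false else decisionAt A B ξ v t
  have hvt : Measurable fun ω : Ξ × (ℕ → ℝ) => ω.2 t :=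
    (measurable_pi_apply t).comp measurable_snd
  have hcm : Measurable fun ω : Ξ × (ℕ → ℝ) => c ω.1 ω.2 := by
    have hpt := measurable_priceAt A B t
    exact Measurable.ite (measurableSet_le (hpt.add_const ε) hvt) measurable_const
      (Measurable.ite (measurableSet_le hvt (hpt.sub_const ε)) measurable_const
        (measurable_decisionAt A B t))
  obtain ⟨B', hB'⟩ := exists_buyerPolicy A
    (fun n ξ v => overrideDecision t D (c ξ v) (decisionAt A B ξ v) n)
    (fun n => by
      unfold overrideDecision
      split_ifs
      · exact hcm
      · exact measurable_decisionAt A B n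
      · have : Measurable fun q : Bool × Bool × Bool => q.1 && (q.2.1 == q.2.2) :=
          measurable_of_countable _
        exact this.comp ((measurable_decisionAt A B n).prodMk
          (hcm.prodMk (measurable_decisionAt A B t))))
    (fun n ξ v v' h => by
      have hc' (hn : t ≤ n) : c ξ v = c ξ v' := by
        simp only [c]
        rw [priceAt_congr A B ξ (v := v) (v' := v') fun s hs => h s (by omega), h t hn,
          decisionAt_congr A B ξ (v := v) (v' := v') fun s hs => h s (by omega)]
      have hd (m : ℕ) (hm : m ≤ n) : decisionAt A B ξ v m = decisionAt A B ξ v' m :=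
        decisionAt_congr A B ξ fun s hs => h s (by omega)
      unfold overrideDecision
      split_ifs with h1 h2
      · exact hc' h1.ge
      · exact hd n le_rfl
      · rw [hd n le_rfl, hc' (by omega), hd t (by omega)])
  have hB'' (ω : Ξ × (ℕ → ℝ)) : decisionAt A B' ω.1 ω.2 =
      overrideDecision t D (c ω.1 ω.2) (decisionAt A B ω.1 ω.2) := funext fun n => hB' ω.1 ω.2 n
  have hint := integrable_discountedProfit (ρ := ρ) (γ := γ) T hprice B hv
  have hint' := integrable_discountedProfit (ρ := ρ) (γ := γ) T hprice B' hv
  have hle := hB B'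
  rw [buyerUtility_eq, buyerUtility_eq] at hle
  have hstrict : ∀ᵐ ω ∂(gameLaw ρ 𝒟), c ω.1 ω.2 ≠ decisionAt A B ω.1 ω.2 t →
      discountedProfit γ T A (decisionAt A B ω.1 ω.2) ω.2 <
        discountedProfit γ T A (decisionAt A B' ω.1 ω.2) ω.2 := by
    filter_upwards [ae_value_mem (ρ := ρ) hv] with ω hω hne
    rw [hB'']
    refine discountedProfit_lt_override h0 h1 ht hD hprice hdelay hε hω hne ?_
    rw [← priceAt_eq_decisionPrice]
    simp only [c] at hne ⊢
    split_ifs at hne ⊢ with h2 h3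
    · rw [(Bool.eq_false_iff.2 hne.symm : decisionAt A B ω.1 ω.2 t = false)]
      simp only [purchase, if_true, Bool.false_eq_true, if_false]
      linarith
    · rw [(by simpa using hne : decisionAt A B ω.1 ω.2 t = true)]
      simp only [purchase, if_true, Bool.false_eq_true, if_false]
      linarith
    · exact absurd rfl hne
  -- The deviation never loses almost surely, and optimality of `B` forbids a gain in expectation.
  -- So the difference vanishes almost surely, and strictness forces `c` to agree with `B`.
  have hnonneg : 0 ≤ᵐ[gameLaw ρ 𝒟] fun ω =>
      discountedProfit γ T A (decisionAt A B' ω.1 ω.2) ω.2 -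
        discountedProfit γ T A (decisionAt A B ω.1 ω.2) ω.2 := by
    filter_upwards [hstrict] with ω hω
    by_cases h : c ω.1 ω.2 = decisionAt A B ω.1 ω.2 t
    · rw [hB'', h, overrideDecision_self]
      simp
    · exact (sub_pos.2 (hω h)).le
  have hzero := (integral_eq_zero_iff_of_nonneg_ae hnonneg (hint'.sub hint)).1
    (le_antisymm (by
      rw [integral_sub hint' hint]
      linarith) (integral_nonneg_of_ae hnonneg))
  filter_upwards [hstrict, hzero] with ω h2 h3
  have h4 : c ω.1 ω.2 = decisionAt A B ω.1 ω.2 t := by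
    by_contra h
    have := h2 h
    simp only [Pi.zero_apply] at h3
    linarith
  rw [← h4]
  refine ⟨fun h => by simp [c, h], fun h => ?_⟩
  simp only [c]
  rw [if_neg (by linarith), if_pos h]

end Deviation

/-! ### From threshold frequencies to concentration of revenues -/

section Deterministic

lemma sum_filter_pullHistory {α : Type*} [LinearOrder α] [Inhabited α] (arms : Finset α) (T D : ℕ)
    (δ : ℝ) (R : ℕ → α → ℝ) (i : α) (m : ℕ) :
    (((pullHistory arms T D δ R m).filter (fun x => decide (x.1 = i))).map Prod.snd).sum =
      ∑ s ∈ Finset.range m, if pulledArm arms T D δ R s = i then R s i else 0 := by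
  induction m with
  | zero => simp [pullHistory]
  | succ m ih =>
    rw [pullHistory_succ, List.filter_append, List.map_append, List.sum_append, ih,
      Finset.sum_range_succ]
    congr 1
    by_cases h : pulledArm arms T D δ R m = i
    · subst h
      simp
    · simp [h]

/-- The number of occurrences of `p` in the first `m` entries of `q`. -/
def occurrences (q : ℕ → ℝ) (p : ℝ) (m : ℕ) : ℕ := {s ∈ Finset.range m | q s = p}.card

lemma occurrences_succ (q : ℕ → ℝ) (p : ℝ) (m : ℕ) :
    occurrences q p (m + 1) = occurrences q p m + if q m = p then 1 else 0 := by
  unfold occurrences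
  rw [Finset.range_add_one, Finset.filter_insert]
  split_ifs with h
  · rw [Finset.card_insert_of_notMem (by simp)]
  · rfl

lemma occurrences_mono (q : ℕ → ℝ) (p : ℝ) : Monotone (occurrences q p) :=
  monotone_nat_of_le_succ fun m => by rw [occurrences_succ]; omega

lemma occurrences_le (q : ℕ → ℝ) (p : ℝ) (m : ℕ) : occurrences q p m ≤ m :=
  (Finset.card_filter_le _ _).trans (Finset.card_range m).le

/-- Indicator of the first `n` occurrences of `p` in `q`. -/
def earlyOccurrence (q : ℕ → ℝ) (p : ℝ) (n t : ℕ) : ℝ :=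
  if q t = p ∧ occurrences q p t < n then 1 else 0

lemma earlyOccurrence_mem (q : ℕ → ℝ) (p : ℝ) (n t : ℕ) :
    earlyOccurrence q p n t ∈ Icc (0 : ℝ) 1 := by
  unfold earlyOccurrence
  split_ifs <;> simp

lemma sum_earlyOccurrence_le (q : ℕ → ℝ) (p : ℝ) (n m : ℕ) :
    ∑ t ∈ Finset.range m, earlyOccurrence q p n t ≤ n := by
  have : ∑ t ∈ Finset.range m, earlyOccurrence q p n t = (min (occurrences q p m) n : ℕ) := by
    induction m with
    | zero => simp [occurrences]
    | succ m ih =>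
      rw [Finset.sum_range_succ, ih, occurrences_succ, earlyOccurrence]
      by_cases h1 : q m = p <;> by_cases h2 : occurrences q p m < n <;> simp only [h1, h2, true_and,
        false_and, if_true, if_false, add_zero]
      · rw [min_eq_left h2.le, min_eq_left (by omega)]
        push_cast
        rfl
      · rw [min_eq_right (by omega), min_eq_right (by omega)]
  rw [this]
  exact_mod_cast min_le_right _ _

/-- A sum up to a time `m` becomes a sum over the first `n` occurrences within the fixed horizon, so
a union bound over `n ≤ T` covers random numbers of pulls. -/
lemma sum_earlyOccurrence_mul (q : ℕ → ℝ) (p : ℝ) (φ : ℕ → ℝ) {m T : ℕ} (hm : m ≤ T) :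
    ∑ t ∈ Finset.range T, earlyOccurrence q p (occurrences q p m) t * φ t =
      ∑ t ∈ Finset.range m, if q t = p then φ t else 0 := by
  rw [← Finset.sum_subset (Finset.range_subset_range.2 hm)]
  · refine Finset.sum_congr rfl fun t ht => ?_
    have h1 := occurrences_mono q p (Nat.succ_le_of_lt (Finset.mem_range.1 ht))
    simp only [Nat.succ_eq_add_one, occurrences_succ] at h1
    unfold earlyOccurrence
    by_cases h : q t = p
    · rw [if_pos h] at h1 ⊢
      rw [if_pos ⟨h, by omega⟩, one_mul]
    · simp [h]
  · intro t _ ht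
    have h1 := occurrences_mono q p (not_lt.1 fun h => ht (Finset.mem_range.2 h))
    unfold earlyOccurrence
    rw [if_neg (by omega), zero_mul]

/-- The indicator of `v ≥ x`. -/
def aboveIndicator (x v : ℝ) : ℝ := (Ici x).indicator 1 v

lemma aboveIndicator_mem (x v : ℝ) : aboveIndicator x v ∈ Icc (0 : ℝ) 1 := by
  unfold aboveIndicator
  by_cases h : v ∈ Ici x <;> simp [h]

/-- If the decisions are sandwiched between two threshold rules whose empirical frequencies are
close to the demand, the empirical revenues are close to the revenue curve. -/
lemma concentrated_of_sandwich {𝒟 : Measure ℝ} {K T D : ℕ} {δ ε : ℝ} (hT : 2 ≤ T) (hδ : 0 ≤ δ)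
    (hf : ∀ p ∈ priceGrid K, revenue 𝒟 p ∈ Icc (0 : ℝ) 1)
    {b : ℕ → Bool} {v q : ℕ → ℝ}
    (hq : ∀ t, q t = pulledArm (priceGrid K) T D δ (decisionReward b) t)
    (hbuy : ∀ t < T, q t + ε ≤ v t → b t = true)
    (hnot : ∀ t < T, v t ≤ q t - ε → b t = false)
    (hup : ∀ p, demand 𝒟 (p - ε) ≤ demand 𝒟 p + δ)
    (hlow : ∀ p, demand 𝒟 p - δ ≤ demand 𝒟 (p + ε))
    (hU : ∀ p ∈ priceGrid K, ∀ n ∈ Finset.Icc 1 T, ∑ t ∈ Finset.range T,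
      earlyOccurrence q p n t * (aboveIndicator (p - ε) (v t) - demand 𝒟 (p - ε)) <
        Real.sqrt (2 * n * Real.log T))
    (hL : ∀ p ∈ priceGrid K, ∀ n ∈ Finset.Icc 1 T, ∑ t ∈ Finset.range T,
      earlyOccurrence q p n t * (demand 𝒟 (p + ε) - aboveIndicator (p + ε) (v t)) <
        Real.sqrt (2 * n * Real.log T)) :
    Concentrated (priceGrid K) T D δ (decisionReward b) (revenue 𝒟) := by
  intro m hm p hp
  have hT' : (2 : ℝ) ≤ T := by exact_mod_cast hT
  have hlogT : 1 / 2 ≤ Real.log T := by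
    have := Real.log_le_log (by norm_num) hT'
    linarith [Real.log_two_gt_d9]
  have hpulls : pulls (priceGrid K) T D δ (decisionReward b) p m = occurrences q p m := by
    unfold pulls occurrences
    simp only [hq]
  rw [empiricalMean, sum_filter_pullHistory, pullCount_pullHistory, hpulls]
  simp only [← hq]
  -- Without any pull the empirical mean is `0` with count `1`; for `T ≥ 2` the radius `√(2 log T)`
  -- is at least `1` and covers every revenue.
  rcases Nat.eq_zero_or_pos (occurrences q p m) with h0 | h0
  · have hz : ∑ s ∈ Finset.range m, (if q s = p then decisionReward b s p else 0) = 0 := by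
      refine Finset.sum_eq_zero fun s hs => if_neg fun h => ?_
      have := Finset.card_eq_zero.1 h0
      exact Finset.notMem_empty s (this ▸ Finset.mem_filter.2 ⟨hs, h⟩)
    rw [hz, h0]
    have h1 : 1 ≤ Real.sqrt (2 * Real.log T) := Real.one_le_sqrt.2 (by linarith)
    have h2 := hf p hp
    simp only [zero_sub, abs_neg, abs_of_nonneg h2.1, zero_le, sup_of_le_right,
      Nat.cast_one, div_one]
    linarith [h2.2]
  · set n := occurrences q p m with hn
    have hnmem : n ∈ Finset.Icc 1 T := Finset.mem_Icc.2 ⟨h0, (occurrences_le q p m).trans hm⟩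
    have hU' := hU p hp n hnmem
    have hL' := hL p hp n hnmem
    rw [hn, sum_earlyOccurrence_mul q p
      (fun t => aboveIndicator (p - ε) (v t) - demand 𝒟 (p - ε)) hm,
      ← hn] at hU'
    rw [hn, sum_earlyOccurrence_mul q p
      (fun t => demand 𝒟 (p + ε) - aboveIndicator (p + ε) (v t)) hm,
      ← hn] at hL'
    have hnpos : (0 : ℝ) < n := by exact_mod_cast h0
    have hcount (c : ℝ) : ∑ t ∈ Finset.range m, (if q t = p then c else 0) = n * c := by
      rw [← Finset.sum_filter, Finset.sum_const, nsmul_eq_mul]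
      rfl
    set S := ∑ t ∈ Finset.range m, if q t = p then purchase (b t) else 0 with hS
    have hsum : ∑ s ∈ Finset.range m, (if q s = p then decisionReward b s p else 0) = p * S := by
      rw [hS, Finset.mul_sum]
      exact Finset.sum_congr rfl fun s _ => by split_ifs <;> simp [decisionReward]
    -- Every purchase at price `p` has a value of at least `p - ε`; conversely, in `hS2`, every
    -- value of at least `p + ε` yields a purchase.
    have hS1 : S - n * demand 𝒟 (p - ε) < Real.sqrt (2 * n * Real.log T) := by
      refine lt_of_le_of_lt ?_ hU'
      rw [hS, ← hcount, ← Finset.sum_sub_distrib]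
      refine Finset.sum_le_sum fun t ht => ?_
      have htT : t < T := (Finset.mem_range.1 ht).trans_le hm
      split_ifs with h
      · refine sub_le_sub_right ?_ _
        unfold aboveIndicator
        by_cases hv : v t ∈ Ici (p - ε)
        · rw [indicator_of_mem hv]
          exact purchase_le_one _
        · rw [hnot t htT (by rw [h]; exact (not_le.1 hv).le), indicator_of_notMem hv]
          simp [purchase]
      · simp
    have hS2 : n * demand 𝒟 (p + ε) - S < Real.sqrt (2 * n * Real.log T) := by
      refine lt_of_le_of_lt ?_ hL'
      rw [hS, ← hcount, ← Finset.sum_sub_distrib]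
      refine Finset.sum_le_sum fun t ht => ?_
      have htT : t < T := (Finset.mem_range.1 ht).trans_le hm
      split_ifs with h
      · refine sub_le_sub_left ?_ _
        unfold aboveIndicator
        by_cases hv : v t ∈ Ici (p + ε)
        · rw [hbuy t htT (by rw [h]; exact hv), indicator_of_mem hv]
          simp [purchase]
        · rw [indicator_of_notMem hv]
          exact purchase_nonneg _
      · simp
    have hsqrt : Real.sqrt (2 * n * Real.log T) = n * Real.sqrt (2 * Real.log T / n) := by
      rw [← Real.sqrt_sq hnpos.le, ← Real.sqrt_mul (by positivity), Real.sqrt_sq hnpos.le]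
      congr 1
      field_simp
    rw [max_eq_left (by omega : 1 ≤ n), hsum]
    set w := Real.sqrt (2 * Real.log T / n)
    have hw : 0 ≤ w := Real.sqrt_nonneg _
    rw [hsqrt] at hS1 hS2
    have hp01 := mem_Icc_of_mem_priceGrid hp
    have hmean1 : S / n ≤ demand 𝒟 p + δ + w := by
      rw [div_le_iff₀ hnpos]
      have := mul_le_mul_of_nonneg_left (hup p) hnpos.le
      linarith
    have hmean2 : demand 𝒟 p - δ - w ≤ S / n := by
      rw [le_div_iff₀ hnpos]
      have := mul_le_mul_of_nonneg_left (hlow p) hnpos.le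
      linarith
    have habs : |S / n - demand 𝒟 p| ≤ w + δ := abs_le.2 ⟨by linarith, by linarith⟩
    rw [revenue, mul_div_assoc, ← mul_sub, abs_mul, abs_of_nonneg hp01.1]
    exact (mul_le_of_le_one_left (abs_nonneg _) hp01.2).trans habs

end Deterministic

/-! ### Hoeffding's inequality for predictable selections -/

section Hoeffding

variable {Ξ : Type*} [MeasurableSpace Ξ] {ρ : Measure Ξ} [IsProbabilityMeasure ρ]
  {𝒟 : Measure ℝ} [IsProbabilityMeasure 𝒟]

lemma integral_exp_mul_le {g : ℝ → ℝ} (hg : Measurable g) (hg01 : ∀ x, g x ∈ Icc (0 : ℝ) 1)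
    (c : ℝ) : ∫ x, Real.exp (c * (g x - ∫ y, g y ∂𝒟)) ∂𝒟 ≤ Real.exp (c ^ 2 / 8) := by
  have h := (ProbabilityTheory.hasSubgaussianMGF_of_mem_Icc (μ := 𝒟) hg.aemeasurable
    (Eventually.of_forall hg01)).mgf_le c
  unfold ProbabilityTheory.mgf at h
  refine h.trans (le_of_eq ?_)
  congr 1
  simp
  ring

/-- A process whose value at time `t` does not depend on the values of the rounds from `t` on. -/
def Predictable (Z : ℕ → Ξ × (ℕ → ℝ) → ℝ) : Prop :=
  ∀ t ξ v v', (∀ s < t, v s = v' s) → Z t (ξ, v) = Z t (ξ, v')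

lemma measurable_partialSums {Z : ℕ → Ξ × (ℕ → ℝ) → ℝ} (hZm : ∀ t, Measurable (Z t)) {g : ℝ → ℝ}
    (hg : Measurable g) (m c e : ℝ) (t : ℕ) :
    Measurable fun ω : Ξ × (ℕ → ℝ) => Real.exp
      (∑ s ∈ Finset.range t, (c * (Z s ω * (g (ω.2 s) - m)) - e * Z s ω)) := by
  refine Real.measurable_exp.comp (Finset.measurable_sum _ fun s _ => ?_)
  have h1 : Measurable fun ω : Ξ × (ℕ → ℝ) => g (ω.2 s) :=
    hg.comp ((measurable_pi_apply s).comp measurable_snd)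
  exact (((hZm s).mul (h1.sub_const m)).const_mul c).sub ((hZm s).const_mul e)

/-- An exponential supermartingale: resampling value `t` freezes the past and `Z t`, and Hoeffding's
lemma applies with `c * Z t`. Since `Z ^ 2 ≤ Z`, the compensator can be linear in `Z`, so its total
scales with the number of selected rounds, not with the horizon. -/
lemma integral_exp_partialSums_le_one {Z : ℕ → Ξ × (ℕ → ℝ) → ℝ} (hZm : ∀ t, Measurable (Z t))
    (hZ01 : ∀ t ω, Z t ω ∈ Icc (0 : ℝ) 1) (hZ : Predictable Z) {g : ℝ → ℝ} (hg : Measurable g)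
    (hg01 : ∀ x, g x ∈ Icc (0 : ℝ) 1) (c : ℝ) (t : ℕ) :
    Integrable (fun ω : Ξ × (ℕ → ℝ) => Real.exp (∑ s ∈ Finset.range t,
      (c * (Z s ω * (g (ω.2 s) - ∫ y, g y ∂𝒟)) - c ^ 2 / 8 * Z s ω))) (gameLaw ρ 𝒟) ∧
    ∫ ω, Real.exp (∑ s ∈ Finset.range t,
      (c * (Z s ω * (g (ω.2 s) - ∫ y, g y ∂𝒟)) - c ^ 2 / 8 * Z s ω)) ∂(gameLaw ρ 𝒟) ≤ 1 := by
  set m := ∫ y, g y ∂𝒟 with hm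
  have hgint : Integrable g 𝒟 := Integrable.of_bound hg.aestronglyMeasurable 1
    (Eventually.of_forall fun x => by
      rw [Real.norm_eq_abs, abs_of_nonneg (hg01 x).1]; exact (hg01 x).2)
  have hm0 : 0 ≤ m := integral_nonneg fun x => (hg01 x).1
  have hm1 : m ≤ 1 := by
    have := integral_mono hgint (integrable_const (1 : ℝ)) fun x => (hg01 x).2
    simpa using this
  have hint (t : ℕ) : Integrable (fun ω : Ξ × (ℕ → ℝ) => Real.exp (∑ s ∈ Finset.range t,
      (c * (Z s ω * (g (ω.2 s) - m)) - c ^ 2 / 8 * Z s ω))) (gameLaw ρ 𝒟) := by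
    refine Integrable.of_bound (C := Real.exp (t * |c|))
      (measurable_partialSums hZm hg m c (c ^ 2 / 8) t).aestronglyMeasurable
      (Eventually.of_forall fun ω => ?_)
    rw [Real.norm_eq_abs, Real.abs_exp, Real.exp_le_exp]
    refine (Finset.sum_le_card_nsmul _ _ |c| fun s _ => ?_).trans (by simp)
    have h1 := hZ01 s ω
    have h2 := hg01 (ω.2 s)
    have h3 : |Z s ω * (g (ω.2 s) - m)| ≤ 1 := by
      rw [abs_mul, abs_of_nonneg h1.1]
      exact mul_le_one₀ h1.2 (abs_nonneg _)
        (abs_le.2 ⟨by linarith [h2.1], by linarith [h2.2]⟩)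
    have h4 : c * (Z s ω * (g (ω.2 s) - m)) ≤ |c| := by
      refine (le_abs_self _).trans ?_
      rw [abs_mul]
      exact mul_le_of_le_one_right (abs_nonneg c) h3
    have h5 : 0 ≤ c ^ 2 / 8 * Z s ω := mul_nonneg (by positivity) h1.1
    linarith
  refine ⟨hint t, ?_⟩
  induction t with
  | zero => simp
  | succ t ih =>
    refine le_trans ?_ ih
    rw [integral_resample t (hint (t + 1))]
    refine integral_mono ?_ (hint t) fun ω => ?_
    · exact ((measurePreserving_resample (ρ := ρ) (𝒟 := 𝒟) t).integrable_comp_of_integrable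
        (hint (t + 1))).integral_prod_left
    · have hup (x : ℝ) (s : ℕ) (hs : s ≤ t) :
          Z s (ω.1, Function.update ω.2 t x) = Z s ω :=
        hZ s ω.1 _ _ fun r hr => Function.update_of_ne (by omega) _ _
      have hpast (x : ℝ) : Real.exp (∑ s ∈ Finset.range (t + 1),
          (c * (Z s (ω.1, Function.update ω.2 t x) * (g (Function.update ω.2 t x s) - m)) -
            c ^ 2 / 8 * Z s (ω.1, Function.update ω.2 t x))) =
          Real.exp (∑ s ∈ Finset.range t,
            (c * (Z s ω * (g (ω.2 s) - m)) - c ^ 2 / 8 * Z s ω)) *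
            Real.exp (- (c ^ 2 / 8 * Z t ω)) * Real.exp (c * Z t ω * (g x - m)) := by
        rw [Finset.sum_range_succ, hup x t le_rfl, Function.update_self, ← Real.exp_add,
          ← Real.exp_add]
        congr 1
        have : ∑ s ∈ Finset.range t,
            (c * (Z s (ω.1, Function.update ω.2 t x) * (g (Function.update ω.2 t x s) - m)) -
              c ^ 2 / 8 * Z s (ω.1, Function.update ω.2 t x)) =
            ∑ s ∈ Finset.range t, (c * (Z s ω * (g (ω.2 s) - m)) - c ^ 2 / 8 * Z s ω) := by
          refine Finset.sum_congr rfl fun s hs => ?_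
          have hs := Finset.mem_range.1 hs
          rw [hup x s hs.le, Function.update_of_ne hs.ne]
        rw [this]
        ring
      simp only [hpast]
      rw [integral_const_mul, mul_assoc]
      refine mul_le_of_le_one_right (Real.exp_pos _).le ?_
      have h1 := integral_exp_mul_le (𝒟 := 𝒟) hg hg01 (c * Z t ω)
      have h2 : Real.exp ((c * Z t ω) ^ 2 / 8) ≤ Real.exp (c ^ 2 / 8 * Z t ω) := by
        rw [Real.exp_le_exp]
        have h3 := hZ01 t ω
        have h4 : Z t ω ^ 2 ≤ Z t ω := by nlinarith [h3.1, h3.2]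
        have h5 := mul_le_mul_of_nonneg_left h4 (by positivity : 0 ≤ c ^ 2 / 8)
        linarith
      calc _ ≤ Real.exp (- (c ^ 2 / 8 * Z t ω)) * Real.exp (c ^ 2 / 8 * Z t ω) :=
            mul_le_mul_of_nonneg_left (h1.trans h2) (Real.exp_pos _).le
        _ = 1 := by rw [← Real.exp_add]; simp

/-- Hoeffding's inequality for a predictable selection of at most `n` of the values. -/
theorem measureReal_predictable_sum_ge_le {Z : ℕ → Ξ × (ℕ → ℝ) → ℝ} (hZm : ∀ t, Measurable (Z t))
    (hZ01 : ∀ t ω, Z t ω ∈ Icc (0 : ℝ) 1) (hZ : Predictable Z) {g : ℝ → ℝ} (hg : Measurable g)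
    (hg01 : ∀ x, g x ∈ Icc (0 : ℝ) 1) {T n : ℕ} (hn : 1 ≤ n)
    (hsum : ∀ ω, ∑ t ∈ Finset.range T, Z t ω ≤ n) {r : ℝ} (hr : 0 ≤ r) :
    (gameLaw ρ 𝒟).real {ω | r ≤ ∑ t ∈ Finset.range T, Z t ω * (g (ω.2 t) - ∫ y, g y ∂𝒟)} ≤
      Real.exp (-(2 * r ^ 2 / n)) := by
  have hn' : (0 : ℝ) < n := by exact_mod_cast hn
  -- The maximizer of `c * r - c ^ 2 / 8 * n`, with maximum `2 * r ^ 2 / n`.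
  set c := 4 * r / n with hc
  have hc0 : 0 ≤ c := by positivity
  obtain ⟨hint, hle⟩ := integral_exp_partialSums_le_one (ρ := ρ) (𝒟 := 𝒟) hZm hZ01 hZ hg hg01 c T
  have hmarkov := mul_meas_ge_le_integral_of_nonneg
    (Eventually.of_forall fun ω => (Real.exp_pos _).le) hint (Real.exp (2 * r ^ 2 / n))
  have hsub : (gameLaw ρ 𝒟).real
      {ω | r ≤ ∑ t ∈ Finset.range T, Z t ω * (g (ω.2 t) - ∫ y, g y ∂𝒟)} ≤
      (gameLaw ρ 𝒟).real {ω | Real.exp (2 * r ^ 2 / n) ≤ Real.exp (∑ s ∈ Finset.range T,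
        (c * (Z s ω * (g (ω.2 s) - ∫ y, g y ∂𝒟)) - c ^ 2 / 8 * Z s ω))} := by
    refine measureReal_mono fun ω hω => ?_
    rw [mem_ofPred_eq] at hω ⊢
    rw [Real.exp_le_exp, Finset.sum_sub_distrib, ← Finset.mul_sum, ← Finset.mul_sum]
    have h1 := mul_le_mul_of_nonneg_left hω hc0
    have h2 := mul_le_mul_of_nonneg_left (hsum ω) (by positivity : 0 ≤ c ^ 2 / 8)
    have h3 : c * r - c ^ 2 / 8 * n = 2 * r ^ 2 / n := by
      rw [hc]; field_simp; ring
    linarith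
  refine hsub.trans ?_
  rw [Real.exp_neg, ← one_div, le_div_iff₀ (Real.exp_pos _), mul_comm]
  exact hmarkov.trans hle

end Hoeffding

/-! ### Inverse squared distances to the integers -/

section Numeric

lemma sum_inv_sq_le_two (s : Finset ℕ) (x : ℕ → ℝ) (e : ℕ → ℕ) (he : InjOn e s)
    (he1 : ∀ i ∈ s, 1 ≤ e i) (hx : ∀ i ∈ s, (e i : ℝ) ≤ |x i|) :
    ∑ i ∈ s, ((x i) ^ 2)⁻¹ ≤ 2 := by
  calc ∑ i ∈ s, ((x i) ^ 2)⁻¹ ≤ ∑ i ∈ s, ((e i : ℝ) ^ 2)⁻¹ := by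
        refine Finset.sum_le_sum fun i hi => ?_
        have h1 : (1 : ℝ) ≤ e i := by exact_mod_cast he1 i hi
        rw [← sq_abs (x i)]
        have := hx i hi
        gcongr
    _ = ∑ j ∈ s.image e, ((j : ℝ) ^ 2)⁻¹ :=
        (Finset.sum_image (f := fun j : ℕ => ((j : ℝ) ^ 2)⁻¹) he).symm
    _ ≤ ∑ j ∈ Finset.Ioo 0 ((s.image e).sup id + 1), ((j : ℝ) ^ 2)⁻¹ := by
        refine Finset.sum_le_sum_of_subset_of_nonneg (fun j hj => ?_) fun j _ _ => by positivity
        obtain ⟨i, hi, rfl⟩ := Finset.mem_image.1 hj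
        exact Finset.mem_Ioo.2 ⟨he1 i hi, Nat.lt_succ_of_le (Finset.le_sup (f := id) hj)⟩
    _ ≤ 2 := by
        have := sum_Ioo_inv_sq_le (α := ℝ) 0 ((s.image e).sup id + 1)
        simpa using this

/-- On either side of `a` the distances dominate distinct positive integers, `⌊a⌋₊ - i` or `i -
⌈a⌉₊`, so each side contributes at most `2`. Nearer points must be left out; their gaps are paid for
by the discretization error. -/
lemma sum_inv_sq_far_le_four {a : ℝ} (ha : 0 ≤ a) (s : Finset ℕ) :
    ∑ i ∈ s, (if 1 ≤ |a - i| then ((a - i) ^ 2)⁻¹ else 0) ≤ 4 := by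
  rw [← Finset.sum_filter]
  have hsub : s.filter (fun i : ℕ => 1 ≤ |a - i|) =
      s.filter (fun i : ℕ => (i : ℝ) + 1 ≤ a) ∪ s.filter (fun i : ℕ => a + 1 ≤ (i : ℝ)) := by
    ext i
    simp only [Finset.mem_filter, Finset.mem_union, le_abs]
    constructor
    · rintro ⟨h, h1 | h1⟩
      · exact Or.inl ⟨h, by linarith⟩
      · exact Or.inr ⟨h, by linarith⟩
    · rintro (⟨h, h1⟩ | ⟨h, h1⟩)
      · exact ⟨h, Or.inl (by linarith)⟩
      · exact ⟨h, Or.inr (by linarith)⟩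
  rw [hsub]
  have hdisj : Disjoint (s.filter fun i : ℕ => (i : ℝ) + 1 ≤ a)
      (s.filter fun i : ℕ => a + 1 ≤ (i : ℝ)) := by
    rw [Finset.disjoint_filter]
    intro i _ h1 h2
    linarith
  rw [Finset.sum_union hdisj]
  have hlow (i : ℕ) (hi : (i : ℝ) + 1 ≤ a) : i + 1 ≤ ⌊a⌋₊ :=
    Nat.le_floor (by push_cast; exact hi)
  have hupp (i : ℕ) (hi : a + 1 ≤ (i : ℝ)) : ⌈a⌉₊ + 1 ≤ i := by
    have h0 : 1 ≤ i := by
      have : (1 : ℝ) ≤ i := by linarith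
      exact_mod_cast this
    have : ⌈a⌉₊ ≤ i - 1 := Nat.ceil_le.2 (by push_cast [h0]; linarith)
    omega
  have h1 : ∑ i ∈ s.filter (fun i : ℕ => (i : ℝ) + 1 ≤ a), ((a - i) ^ 2)⁻¹ ≤ 2 := by
    refine sum_inv_sq_le_two _ (fun i : ℕ => a - i) (fun i => ⌊a⌋₊ - i) ?_ ?_ ?_
    · intro i hi j hj hij
      have h1 := hlow i (Finset.mem_filter.1 hi).2
      have h2 := hlow j (Finset.mem_filter.1 hj).2
      simp only at hij
      omega
    · intro i hi
      have h1 := hlow i (Finset.mem_filter.1 hi).2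
      omega
    · intro i hi
      have h1 := hlow i (Finset.mem_filter.1 hi).2
      rw [Nat.cast_sub (by omega)]
      refine le_trans ?_ (le_abs_self _)
      linarith [Nat.floor_le ha]
  have h2 : ∑ i ∈ s.filter (fun i : ℕ => a + 1 ≤ (i : ℝ)), ((a - i) ^ 2)⁻¹ ≤ 2 := by
    refine sum_inv_sq_le_two _ (fun i : ℕ => a - i) (fun i => i - ⌈a⌉₊) ?_ ?_ ?_
    · intro i hi j hj hij
      have h1 := hupp i (Finset.mem_filter.1 hi).2
      have h2 := hupp j (Finset.mem_filter.1 hj).2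
      simp only at hij
      omega
    · intro i hi
      have h1 := hupp i (Finset.mem_filter.1 hi).2
      omega
    · intro i hi
      have h1 := hupp i (Finset.mem_filter.1 hi).2
      rw [Nat.cast_sub (by omega), abs_sub_comm]
      refine le_trans ?_ (le_abs_self _)
      linarith [Nat.le_ceil a]
  linarith

end Numeric

/-! ### Regret on the price grid -/

section GridRegret

lemma priceGrid_injOn {K : ℕ} (hK : 1 ≤ K) (s : Set ℕ) :
    InjOn (fun i : ℕ => (i : ℝ) / (K : ℝ)) s := by
  intro i _ j _ hij
  have hK' : (K : ℝ) ≠ 0 := by positivity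
  simp only [div_left_inj' hK', Nat.cast_inj] at hij
  exact hij

lemma card_priceGrid {K : ℕ} (hK : 1 ≤ K) : (priceGrid K).card = K := by
  rw [priceGrid, Finset.card_image_of_injOn (priceGrid_injOn hK _), Nat.card_Icc]
  omega

/-- Rounding up keeps the index between `1` and `K`, as `0 < p < 1`. -/
lemma exists_priceGrid_near {K : ℕ} (hK : 1 ≤ K) {p : ℝ} (hp : p ∈ Ioo (0 : ℝ) 1) :
    ∃ q ∈ priceGrid K, (p - q) ^ 2 ≤ 1 / (K : ℝ) ^ 2 := by
  have hK' : (0 : ℝ) < K := by exact_mod_cast hK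
  refine ⟨(⌈p * K⌉₊ : ℝ) / K, mem_priceGrid.2 ⟨⌈p * K⌉₊, Nat.ceil_pos.2 (mul_pos hp.1 hK'),
    Nat.ceil_le.2 (mul_le_of_le_one_left hK'.le hp.2.le), rfl⟩, ?_⟩
  have h1 := Nat.le_ceil (p * K)
  have h2 := Nat.ceil_lt_add_one (mul_pos hp.1 hK').le
  have h3 : p - (⌈p * K⌉₊ : ℝ) / K = (p * K - ⌈p * K⌉₊) / K := by field_simp
  rw [h3, div_pow]
  gcongr
  rw [sq_le_one_iff_abs_le_one, abs_le]
  constructor <;> linarith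

lemma sum_pulls_mul {α : Type*} [LinearOrder α] [Inhabited α] {arms : Finset α} {T D : ℕ} {δ : ℝ}
    {R : ℕ → α → ℝ} (hmem : ∀ t, pulledArm arms T D δ R t ∈ arms) (G : α → ℝ) (m : ℕ) :
    ∑ t ∈ Finset.range m, G (pulledArm arms T D δ R t) =
      ∑ i ∈ arms, (pulls arms T D δ R i m : ℝ) * G i := by
  rw [← Finset.sum_fiberwise_of_maps_to (t := arms) fun t _ => hmem t]
  refine Finset.sum_congr rfl fun i _ => ?_
  rw [Finset.sum_congr rfl fun t ht => by rw [(Finset.mem_filter.1 ht).2], Finset.sum_const,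
    nsmul_eq_mul]
  rfl

/-- The regret of successive elimination on the price grid when the empirical means concentrate. -/
theorem Concentrated.sum_gap_le {f : ℝ → ℝ} {K T D : ℕ} {δ : ℝ} {R : ℕ → ℝ → ℝ}
    (hc : Concentrated (priceGrid K) T D δ R f) (hK : 1 ≤ K) (hT : 2 ≤ T) (hD : 1 ≤ D)
    (hδ : δ = 1 / T) {pstar C₁ C₂ : ℝ} (hp : pstar ∈ Ioo (0 : ℝ) 1) (hC₁ : 0 < C₁) (hC₂ : 0 < C₂)
    (hgap : ∀ p ∈ Icc (0 : ℝ) 1, C₁ * (pstar - p) ^ 2 ≤ f pstar - f p ∧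
      f pstar - f p ≤ C₂ * (pstar - p) ^ 2)
    (hf : ∀ p ∈ Icc (0 : ℝ) 1, f p ∈ Icc (0 : ℝ) 1) :
    ∑ t ∈ Finset.range T, (f pstar - f (pulledArm (priceGrid K) T D δ R t)) ≤
      2 * C₂ * (T / (K : ℝ) ^ 2) + 16 + 3200 * ((K : ℝ) ^ 2 * Real.log T) * C₁⁻¹ +
        D * (1 + Real.log K) + 4 * K := by
  have hK' : (0 : ℝ) < K := by exact_mod_cast hK
  have hT' : (2 : ℝ) ≤ T := by exact_mod_cast hT
  have hlog : 0 ≤ Real.log T := Real.log_nonneg (by linarith)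
  have hδ0 : 0 ≤ δ := by rw [hδ]; positivity
  obtain ⟨b, hb, hmax⟩ := (priceGrid K).exists_max_image f (priceGrid_nonempty hK)
  obtain ⟨u, hu0, husum, hu⟩ := hc.exists_pulls_le hD hδ0 (by omega) hb hmax
  have hbest : f pstar - f b ≤ C₂ / (K : ℝ) ^ 2 := by
    obtain ⟨q, hq, hqle⟩ := exists_priceGrid_near hK hp
    have h1 := (hgap q (mem_Icc_of_mem_priceGrid hq)).2
    have h2 := hmax q hq
    have h3 := mul_le_mul_of_nonneg_left hqle hC₂.le
    rw [mul_one_div] at h3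
    linarith
  let N : ℝ → ℝ := fun p => (pulls (priceGrid K) T D δ R p T : ℝ)
  -- Inverse squared distance to `pstar` in units of the grid, cut off below one cell.
  let h : ℝ → ℝ := fun p =>
    if 1 ≤ |K * pstar - K * p| then ((K * pstar - K * p) ^ 2)⁻¹ else 0
  have hh0 (p : ℝ) : 0 ≤ h p := by
    simp only [h]
    split_ifs <;> positivity
  have hpulled (t : ℕ) := pulledArm_mem (priceGrid K) T D δ R hD hδ0 (priceGrid_nonempty hK) t
  have hN (p : ℝ) : 0 ≤ N p := Nat.cast_nonneg _
  have hNsum : ∑ p ∈ priceGrid K, N p = T := by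
    have := sum_pulls_mul hpulled (fun _ => (1 : ℝ)) T
    simpa using this.symm
  have hhsum : ∑ p ∈ priceGrid K, h p ≤ 4 := by
    rw [priceGrid, Finset.sum_image (priceGrid_injOn hK _)]
    refine le_trans (le_of_eq ?_)
      (sum_inv_sq_far_le_four (mul_nonneg hK'.le hp.1.le) (Finset.Icc 1 K))
    refine Finset.sum_congr rfl fun i _ => ?_
    simp only [h]
    rw [mul_div_cancel₀ _ hK'.ne']
  -- Gaps below the threshold are charged to the horizon. Above it, `2 * C₂ / K ^ 2` is twice the
  -- loss of the best arm, so at least half the gap remains relative to `b`, and it also forces `p`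
  -- to be over one cell from `pstar`; the term `16 / T` ensures a remaining gap of `8 * δ`.
  have harm (p : ℝ) (hpg : p ∈ priceGrid K) : N p * (f pstar - f p) ≤
      N p * (2 * C₂ / (K : ℝ) ^ 2 + 16 / T) +
        800 * ((K : ℝ) ^ 2 * Real.log T) * C₁⁻¹ * h p + D * u p + 4 := by
    have hp01 := mem_Icc_of_mem_priceGrid hpg
    obtain ⟨g1, g2⟩ := hgap p hp01
    set G := f pstar - f p with hG
    have hrest : 0 ≤ 800 * ((K : ℝ) ^ 2 * Real.log T) * C₁⁻¹ * h p := by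
      have := hh0 p
      positivity
    have hDu : 0 ≤ D * u p := mul_nonneg (Nat.cast_nonneg _) (hu0 p)
    by_cases hcase : G ≤ 2 * C₂ / (K : ℝ) ^ 2 + 16 / T
    · have := mul_le_mul_of_nonneg_left hcase (hN p)
      linarith
    · push Not at hcase
      have hA : 0 < C₂ / (K : ℝ) ^ 2 := by positivity
      have hB : (0 : ℝ) < 16 / T := by positivity
      have hA2 : 2 * C₂ / (K : ℝ) ^ 2 = 2 * (C₂ / (K : ℝ) ^ 2) := by ring
      have hGpos : 0 < G := by linarith
      have hG1 : G ≤ 1 := by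
        have h1 := (hf pstar (Ioo_subset_Icc_self hp)).2
        have h2 := (hf p hp01).1
        linarith
      have hΔ : G / 2 ≤ f b - f p := by
        have : f b - f p = G - (f pstar - f b) := by rw [hG]; ring
        linarith
      have h8 : 8 * δ ≤ f b - f p := by
        have : 8 * δ = 16 / T / 2 := by rw [hδ]; ring
        linarith
      have hpull := hu p hpg (by linarith) h8
      have hsq : (1 : ℝ) ≤ (K * pstar - K * p) ^ 2 := by
        have h1 : C₂ / (K : ℝ) ^ 2 < C₂ * (pstar - p) ^ 2 := by linarith
        have h2 : 1 / (K : ℝ) ^ 2 < (pstar - p) ^ 2 := by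
          rw [div_eq_mul_one_div] at h1
          exact lt_of_mul_lt_mul_left h1 hC₂.le
        rw [div_lt_iff₀ (by positivity)] at h2
        rw [← mul_sub, mul_pow]
        linarith
      have hh : h p = ((K * pstar - K * p) ^ 2)⁻¹ := by
        simp only [h]
        exact if_pos ((one_le_sq_iff_one_le_abs _).1 hsq)
      have hx : 0 < (pstar - p) ^ 2 := by
        have h1 : (K * pstar - K * p) ^ 2 = (K : ℝ) ^ 2 * (pstar - p) ^ 2 := by ring
        rw [h1] at hsq
        by_contra hneg
        have : (pstar - p) ^ 2 = 0 := le_antisymm (not_lt.1 hneg) (sq_nonneg _)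
        rw [this] at hsq
        linarith
      have hmain : 200 * Real.log T / (f b - f p) ^ 2 * G ≤
          800 * ((K : ℝ) ^ 2 * Real.log T) * C₁⁻¹ * h p := by
        have e1 : 200 * Real.log T / (f b - f p) ^ 2 * G ≤ 200 * Real.log T / (G / 2) ^ 2 * G := by
          gcongr
        have e2 : 200 * Real.log T / (G / 2) ^ 2 * G = 800 * Real.log T / G := by
          field_simp
          ring
        have e3 : 800 * Real.log T / G ≤ 800 * Real.log T / (C₁ * (pstar - p) ^ 2) := by
          gcongr
        have e4 : 800 * Real.log T / (C₁ * (pstar - p) ^ 2) =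
            800 * ((K : ℝ) ^ 2 * Real.log T) * C₁⁻¹ * h p := by
          rw [hh, ← mul_sub, mul_pow]
          field_simp
        linarith
      have hNG : N p * G ≤ 200 * Real.log T / (f b - f p) ^ 2 * G + (D * u p + 4) * G := by
        rw [← add_mul, ← add_assoc]
        exact mul_le_mul_of_nonneg_right hpull hGpos.le
      have hlast : (D * u p + 4) * G ≤ D * u p + 4 :=
        mul_le_of_le_one_right (by linarith) hG1
      have hNpos : 0 ≤ N p * (2 * C₂ / (K : ℝ) ^ 2 + 16 / T) := by
        have := hN p
        positivity
      linarith
  rw [sum_pulls_mul hpulled (fun p => f pstar - f p)]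
  refine (Finset.sum_le_sum harm).trans ?_
  rw [Finset.sum_add_distrib, Finset.sum_add_distrib, Finset.sum_add_distrib, ← Finset.sum_mul,
    ← Finset.mul_sum, ← Finset.mul_sum, hNsum, Finset.sum_const, card_priceGrid hK, nsmul_eq_mul]
  have hharm := harmonic_le_one_add_log K
  rw [card_priceGrid hK] at husum
  have t1 : T * (2 * C₂ / (K : ℝ) ^ 2 + 16 / T) = 2 * C₂ * (T / (K : ℝ) ^ 2) + 16 := by
    field_simp
  have t2 := mul_le_mul_of_nonneg_left hhsum
    (by positivity : 0 ≤ 800 * ((K : ℝ) ^ 2 * Real.log T) * C₁⁻¹)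
  have t3 := mul_le_mul_of_nonneg_left (husum.trans hharm) (Nat.cast_nonneg (α := ℝ) D)
  linarith

end GridRegret

/-! ### Number of prices and length of the delay -/

section Parameters

/-- The unrounded grid size `x ≥ 1` satisfies `x ≤ K ≤ 2 * x`, and `x ^ 2` is the square root of `T
/ log T`; both regret terms then have order `√(T log T)`. -/
lemma gridSize_bounds {T K : ℕ} (hT : 2 ≤ T)
    (hK : K = ⌈((T : ℝ) / Real.log T) ^ (1 / 4 : ℝ)⌉₊) :
    1 ≤ K ∧ (T : ℝ) / (K : ℝ) ^ 2 ≤ Real.sqrt (T * Real.log T) ∧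
      (K : ℝ) ^ 2 * Real.log T ≤ 4 * Real.sqrt (T * Real.log T) ∧ (K : ℝ) ≤ 8 * T := by
  have hT' : (2 : ℝ) ≤ T := by exact_mod_cast hT
  have hlog : 1 / 2 ≤ Real.log T := by
    have := Real.log_le_log (by norm_num) hT'
    linarith [Real.log_two_gt_d9]
  have hlogT : Real.log T ≤ T := Real.log_le_self (by linarith)
  set y := (T : ℝ) / Real.log T with hy
  have hy1 : 1 ≤ y := (one_le_div (by linarith)).2 hlogT
  have hy2 : y ≤ 2 * T := by
    rw [hy, div_le_iff₀ (by linarith)]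
    nlinarith
  set x := y ^ (1 / 4 : ℝ) with hx
  have hx1 : 1 ≤ x := Real.one_le_rpow hy1 (by norm_num)
  have hx2 : x ^ 2 = Real.sqrt y := by
    rw [hx, ← Real.rpow_natCast, ← Real.rpow_mul (by linarith), Real.sqrt_eq_rpow]
    norm_num
  have hKx : x ≤ K := by rw [hK]; exact Nat.le_ceil x
  have hKx2 : (K : ℝ) ≤ 2 * x := by
    have := Nat.ceil_lt_add_one (by linarith : 0 ≤ x)
    rw [hK]
    linarith
  have hK1 : (1 : ℝ) ≤ K := hx1.trans hKx
  have hzl : Real.sqrt y * Real.log T = Real.sqrt (T * Real.log T) := by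
    rw [← Real.sqrt_sq (by linarith : 0 ≤ Real.log T), ← Real.sqrt_mul (by linarith),
      Real.sqrt_sq (by linarith)]
    congr 1
    rw [hy]
    field_simp
  have hsq1 : Real.sqrt y ≤ (K : ℝ) ^ 2 := by rw [← hx2]; gcongr
  have hsq2 : (K : ℝ) ^ 2 ≤ 4 * Real.sqrt y := by
    rw [← hx2]
    have := pow_le_pow_left₀ (by linarith) hKx2 2
    linarith [mul_pow 2 x 2]
  have hyz : T = y * Real.log T := by rw [hy]; field_simp
  refine ⟨by exact_mod_cast hK1, ?_, ?_, ?_⟩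
  · rw [div_le_iff₀ (by positivity), ← hzl]
    have h1 : (T : ℝ) = Real.sqrt y * Real.log T * Real.sqrt y := by
      rw [mul_right_comm, Real.mul_self_sqrt (by linarith), ← hyz]
    calc (T : ℝ) = Real.sqrt y * Real.log T * Real.sqrt y := h1
      _ ≤ Real.sqrt y * Real.log T * (K : ℝ) ^ 2 := by
        refine mul_le_mul_of_nonneg_left hsq1 (mul_nonneg (Real.sqrt_nonneg _) (by linarith))
  · rw [← hzl, ← mul_assoc]
    exact mul_le_mul_of_nonneg_right hsq2 (by linarith)
  · have h1 : Real.sqrt y ≤ y := by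
      rw [Real.sqrt_le_left (by linarith)]
      nlinarith
    nlinarith

/-- From `γ ≤ exp (-(1 - γ))`, the power `γ ^ D` is at most `exp (-D / Tγ) ≤ 1 / (L * Tγ * T)`. -/
lemma pow_delay_div_le {γ Tγ L : ℝ} {T D : ℕ} (h0 : 0 < γ) (h1 : γ < 1) (hL : 0 < L) (hT : 1 ≤ T)
    (hTγ : Tγ = 1 / (1 - γ)) (hD : D = ⌈Tγ * Real.log (L * Tγ * T)⌉₊) :
    γ ^ D / (1 - γ) ≤ 1 / (L * T) := by
  have hg : 0 < 1 - γ := by linarith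
  have hTγ0 : 0 < Tγ := by rw [hTγ]; positivity
  have hT' : (0 : ℝ) < T := by exact_mod_cast hT
  have h2 : Tγ * Real.log (L * Tγ * T) ≤ D := by rw [hD]; exact Nat.le_ceil _
  have h3 : Real.log (L * Tγ * T) ≤ (1 - γ) * D := by
    have := mul_le_mul_of_nonneg_left h2 hg.le
    rwa [← mul_assoc, hTγ, mul_one_div_cancel hg.ne', one_mul, ← hTγ] at this
  have h4 : γ ≤ Real.exp (-(1 - γ)) := by
    have := Real.add_one_le_exp (-(1 - γ))
    linarith
  have h5 : γ ^ D ≤ (L * Tγ * T)⁻¹ := by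
    calc γ ^ D ≤ Real.exp (-(1 - γ)) ^ D := pow_le_pow_left₀ h0.le h4 D
      _ = Real.exp (-((1 - γ) * D)) := by rw [← Real.exp_nat_mul]; ring_nf
      _ ≤ Real.exp (-Real.log (L * Tγ * T)) := by gcongr
      _ = (L * Tγ * T)⁻¹ := by rw [Real.exp_neg, Real.exp_log (by positivity)]
  rw [div_eq_mul_one_div, ← hTγ]
  calc γ ^ D * Tγ ≤ (L * Tγ * T)⁻¹ * Tγ := mul_le_mul_of_nonneg_right h5 hTγ0.le
    _ = 1 / (L * T) := by field_simp

end Parameters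

/-! ### The demand curve -/

section Demand

variable {𝒟 : Measure ℝ} [IsProbabilityMeasure 𝒟]

lemma demand_mem_Icc (p : ℝ) : demand 𝒟 p ∈ Icc (0 : ℝ) 1 :=
  ⟨measureReal_nonneg, measureReal_le_one⟩

lemma revenue_mem_Icc {p : ℝ} (hp : p ∈ Icc (0 : ℝ) 1) : revenue 𝒟 p ∈ Icc (0 : ℝ) 1 := by
  have h := demand_mem_Icc (𝒟 := 𝒟) p
  exact ⟨mul_nonneg hp.1 h.1, mul_le_one₀ hp.2 h.1 h.2⟩

lemma measurable_aboveIndicator (x : ℝ) : Measurable (aboveIndicator x) :=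
  measurable_one.indicator measurableSet_Ici

lemma integral_aboveIndicator {𝒟 : Measure ℝ} (x : ℝ) : ∫ v, aboveIndicator x v ∂𝒟 = demand 𝒟 x :=
  integral_indicator_one measurableSet_Ici

lemma integrable_aboveIndicator (x : ℝ) : Integrable (aboveIndicator x) 𝒟 :=
  Integrable.of_mem_Icc 0 1 (measurable_aboveIndicator x).aemeasurable
    (Eventually.of_forall (aboveIndicator_mem x))

/-- The demand is `1` at `0` and vanishes right of `1`. If `L < 1`, the point `2 - L` lies there,
and `1 ≤ L * (2 - L) = 1 - (1 - L) ^ 2` is absurd. This yields `log T ≤ log (L * Tγ * T)` in the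
main theorem. -/
lemma one_le_of_lipschitz_demand {L : ℝ≥0} (hv : ∀ᵐ v ∂𝒟, v ∈ Icc (0 : ℝ) 1)
    (hL : LipschitzWith L (demand 𝒟)) : (1 : ℝ) ≤ L := by
  by_contra! hlt
  have h0 : demand 𝒟 0 = 1 := by
    have : 𝒟 (Ici 0) = 1 := by
      rw [prob_compl_eq_zero_iff measurableSet_Ici |>.symm, ← mem_ae_iff]
      filter_upwards [hv] with v hv using hv.1
    simp [demand, measureReal_def, this]
  have h1 : demand 𝒟 (2 - L) = 0 := by
    have : 𝒟 (Ici (2 - L)) = 0 := by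
      rw [measure_eq_zero_iff_ae_notMem]
      filter_upwards [hv] with v hv hmem
      linarith [hv.2, mem_Ici.1 hmem]
    simp [demand, measureReal_def, this]
  have h2 := hL.dist_le_mul 0 (2 - L)
  rw [h0, h1, Real.dist_eq, Real.dist_eq, sub_zero, zero_sub, abs_neg, abs_one,
    abs_of_pos (by linarith : (0 : ℝ) < 2 - L)] at h2
  nlinarith

end Demand

/-! ### Union bound over prices and numbers of pulls -/

section BadEvent

variable {Ξ : Type*} [MeasurableSpace Ξ] {ρ : Measure Ξ} [IsProbabilityMeasure ρ]
  {𝒟 : Measure ℝ} [IsProbabilityMeasure 𝒟] (A : SellerPolicy) (B : BuyerPolicy Ξ)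

lemma measurable_earlyOccurrence (p : ℝ) (n t : ℕ) :
    Measurable fun ω : Ξ × (ℕ → ℝ) => earlyOccurrence (priceAt A B ω.1 ω.2) p n t := by
  have h1 : Measurable fun ω : Ξ × (ℕ → ℝ) => occurrences (priceAt A B ω.1 ω.2) p t := by
    simp only [occurrences, Finset.card_filter]
    exact Finset.measurable_sum _ fun s _ => Measurable.ite
      (measurableSet_eq_fun (measurable_priceAt A B s) measurable_const)
      measurable_const measurable_const
  exact Measurable.ite ((measurableSet_eq_fun (measurable_priceAt A B t) measurable_const).inter
    (measurableSet_lt h1 measurable_const)) measurable_const measurable_const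

lemma predictable_earlyOccurrence (p : ℝ) (n : ℕ) : Predictable
    fun t (ω : Ξ × (ℕ → ℝ)) => earlyOccurrence (priceAt A B ω.1 ω.2) p n t := by
  intro t ξ v v' h
  have hp (s : ℕ) (hs : s ≤ t) : priceAt A B ξ v s = priceAt A B ξ v' s :=
    priceAt_congr A B ξ fun r hr => h r (by omega)
  have hocc : occurrences (priceAt A B ξ v) p t = occurrences (priceAt A B ξ v') p t := by
    unfold occurrences
    congr 1
    refine Finset.filter_congr fun s hs => ?_
    rw [hp s (Finset.mem_range.1 hs).le]
  simp only [earlyOccurrence, hp t le_rfl, hocc]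

/-- The number `n` cancels in the exponent: `2 * (2 * n * log T) / n = 4 * log T`. -/
lemma measureReal_earlyOccurrence_ge_le {g : ℝ → ℝ} (hg : Measurable g)
    (hg01 : ∀ x, g x ∈ Icc (0 : ℝ) 1) (p : ℝ) {n T : ℕ} (hn : 1 ≤ n) (hT : 1 ≤ T) :
    (gameLaw ρ 𝒟).real {ω : Ξ × (ℕ → ℝ) | Real.sqrt (2 * n * Real.log T) ≤
      ∑ t ∈ Finset.range T,
        earlyOccurrence (priceAt A B ω.1 ω.2) p n t * (g (ω.2 t) - ∫ y, g y ∂𝒟)} ≤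
      ((T : ℝ) ^ 4)⁻¹ := by
  have hT' : (1 : ℝ) ≤ T := by exact_mod_cast hT
  have hn' : (0 : ℝ) < n := by exact_mod_cast hn
  have hlog : 0 ≤ Real.log T := Real.log_nonneg hT'
  refine (measureReal_predictable_sum_ge_le (fun t => measurable_earlyOccurrence A B p n t)
    (fun t ω => earlyOccurrence_mem _ p n t) (predictable_earlyOccurrence A B p n) hg hg01 hn
    (fun ω => sum_earlyOccurrence_le _ p n T) (Real.sqrt_nonneg _)).trans (le_of_eq ?_)
  rw [Real.sq_sqrt (by positivity), Real.exp_neg]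
  congr 1
  have : 2 * (2 * n * Real.log T) / n = (4 : ℕ) * Real.log T := by
    field_simp
    norm_num
    ring
  rw [this, Real.exp_nat_mul, Real.exp_log (by linarith)]

/-- Outside of an event of small probability, the empirical frequencies of the values above
`p - ε` and `p + ε` in the first rounds with price `p` are close to the demand. -/
lemma exists_bad_event (S : Finset ℝ) {T : ℕ} (hT : 1 ≤ T) (ε : ℝ) :
    ∃ E : Set (Ξ × (ℕ → ℝ)), MeasurableSet E ∧
      (gameLaw ρ 𝒟).real E ≤ S.card * T * (2 * ((T : ℝ) ^ 4)⁻¹) ∧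
      ∀ ω ∉ E, ∀ p ∈ S, ∀ n ∈ Finset.Icc 1 T,
        ∑ t ∈ Finset.range T, earlyOccurrence (priceAt A B ω.1 ω.2) p n t *
            (aboveIndicator (p - ε) (ω.2 t) - demand 𝒟 (p - ε)) < Real.sqrt (2 * n * Real.log T) ∧
        ∑ t ∈ Finset.range T, earlyOccurrence (priceAt A B ω.1 ω.2) p n t *
            (demand 𝒟 (p + ε) - aboveIndicator (p + ε) (ω.2 t)) <
              Real.sqrt (2 * n * Real.log T) := by
  let E₁ : ℝ → ℕ → Set (Ξ × (ℕ → ℝ)) := fun p n => {ω | Real.sqrt (2 * n * Real.log T) ≤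
    ∑ t ∈ Finset.range T, earlyOccurrence (priceAt A B ω.1 ω.2) p n t *
      (aboveIndicator (p - ε) (ω.2 t) - demand 𝒟 (p - ε))}
  let E₂ : ℝ → ℕ → Set (Ξ × (ℕ → ℝ)) := fun p n => {ω | Real.sqrt (2 * n * Real.log T) ≤
    ∑ t ∈ Finset.range T, earlyOccurrence (priceAt A B ω.1 ω.2) p n t *
      (demand 𝒟 (p + ε) - aboveIndicator (p + ε) (ω.2 t))}
  have h₁ (p : ℝ) (n : ℕ) (hn : 1 ≤ n) : (gameLaw ρ 𝒟).real (E₁ p n) ≤ ((T : ℝ) ^ 4)⁻¹ := by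
    have := measureReal_earlyOccurrence_ge_le (ρ := ρ) (𝒟 := 𝒟) A B
      (measurable_aboveIndicator (p - ε)) (aboveIndicator_mem _) p hn hT
    simpa only [integral_aboveIndicator] using this
  have h₂ (p : ℝ) (n : ℕ) (hn : 1 ≤ n) : (gameLaw ρ 𝒟).real (E₂ p n) ≤ ((T : ℝ) ^ 4)⁻¹ := by
    have := measureReal_earlyOccurrence_ge_le (ρ := ρ) (𝒟 := 𝒟) A B
      (g := fun x => 1 - aboveIndicator (p + ε) x)
      ((measurable_aboveIndicator (p + ε)).const_sub 1)
      (fun x => by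
        have := aboveIndicator_mem (p + ε) x
        exact ⟨by linarith [this.2], by linarith [this.1]⟩) p hn hT
    have hint : ∫ x, (1 - aboveIndicator (p + ε) x) ∂𝒟 = 1 - demand 𝒟 (p + ε) := by
      rw [integral_sub (integrable_const _) (integrable_aboveIndicator _), integral_aboveIndicator]
      simp
    simpa only [hint, sub_sub_sub_cancel_left] using this
  let E := ⋃ q ∈ S ×ˢ Finset.Icc 1 T, (E₁ q.1 q.2 ∪ E₂ q.1 q.2)
  -- The measurable hull has the same measure, so the union itself need not be shown measurable.
  refine ⟨toMeasurable (gameLaw ρ 𝒟) E, measurableSet_toMeasurable _ _, ?_,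
    fun ω hω p hp n hn => ?_⟩
  · rw [measureReal_def, measure_toMeasurable, ← measureReal_def]
    refine (measureReal_biUnion_finset_le _ _).trans ?_
    refine (Finset.sum_le_card_nsmul _ _ (2 * ((T : ℝ) ^ 4)⁻¹) fun q hq => ?_).trans (le_of_eq ?_)
    · have hq1 := (Finset.mem_Icc.1 (Finset.mem_product.1 hq).2).1
      refine (measureReal_union_le _ _).trans ?_
      linarith [h₁ q.1 q.2 hq1, h₂ q.1 q.2 hq1]
    · rw [Finset.card_product, Nat.card_Icc, nsmul_eq_mul]
      push_cast
      simp
  · have hωE : ω ∉ E := fun h => hω (subset_toMeasurable _ _ h)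
    simp only [E, mem_iUnion, not_exists, mem_union, not_or] at hωE
    have := hωE (p, n) (Finset.mem_product.2 ⟨hp, hn⟩)
    exact ⟨not_le.1 this.1, not_le.1 this.2⟩

end BadEvent

/-! ### From posted prices to the regret of the seller -/

section Regret

variable {Ξ : Type*} [MeasurableSpace Ξ] {ρ : Measure Ξ} [IsProbabilityMeasure ρ]
  {𝒟 : Measure ℝ} [IsProbabilityMeasure 𝒟]

/-- The price of a round does not depend on its value, so resampling that value turns the indicator
into the demand. -/
lemma integral_price_mul_aboveIndicator (A : SellerPolicy) (B : BuyerPolicy Ξ) {t : ℕ}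
    (hprice : ∀ ω : Ξ × (ℕ → ℝ), priceAt A B ω.1 ω.2 t ∈ Icc (0 : ℝ) 1) (ε : ℝ) :
    Integrable (fun ω : Ξ × (ℕ → ℝ) => priceAt A B ω.1 ω.2 t *
        aboveIndicator (priceAt A B ω.1 ω.2 t + ε) (ω.2 t)) (gameLaw ρ 𝒟) ∧
    ∫ ω, priceAt A B ω.1 ω.2 t * aboveIndicator (priceAt A B ω.1 ω.2 t + ε) (ω.2 t)
        ∂(gameLaw ρ 𝒟) =
      ∫ ω, priceAt A B ω.1 ω.2 t * demand 𝒟 (priceAt A B ω.1 ω.2 t + ε) ∂(gameLaw ρ 𝒟) := by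
  have hpm := measurable_priceAt A B t
  have hind : Measurable fun ω : Ξ × (ℕ → ℝ) =>
      aboveIndicator (priceAt A B ω.1 ω.2 t + ε) (ω.2 t) := by
    have : (fun ω : Ξ × (ℕ → ℝ) => aboveIndicator (priceAt A B ω.1 ω.2 t + ε) (ω.2 t)) =
        fun ω => if priceAt A B ω.1 ω.2 t + ε ≤ ω.2 t then 1 else 0 := by
      funext ω
      by_cases h : priceAt A B ω.1 ω.2 t + ε ≤ ω.2 t <;> simp [aboveIndicator, h]
    rw [this]
    exact Measurable.ite (measurableSet_le (hpm.add_const ε)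
      ((measurable_pi_apply t).comp measurable_snd)) measurable_const measurable_const
  have hint : Integrable (fun ω : Ξ × (ℕ → ℝ) => priceAt A B ω.1 ω.2 t *
      aboveIndicator (priceAt A B ω.1 ω.2 t + ε) (ω.2 t)) (gameLaw ρ 𝒟) := by
    refine Integrable.of_mem_Icc 0 1 (hpm.mul hind).aemeasurable (Eventually.of_forall fun ω => ?_)
    have h1 := hprice ω
    have h2 := aboveIndicator_mem (priceAt A B ω.1 ω.2 t + ε) (ω.2 t)
    exact ⟨mul_nonneg h1.1 h2.1, mul_le_one₀ h1.2 h2.1 h2.2⟩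
  refine ⟨hint, ?_⟩
  rw [integral_resample t hint]
  refine integral_congr_ae (Eventually.of_forall fun ω => ?_)
  have hp (x : ℝ) : priceAt A B ω.1 (Function.update ω.2 t x) t = priceAt A B ω.1 ω.2 t :=
    priceAt_congr A B ω.1 fun s hs => Function.update_of_ne hs.ne _ _
  simp only [hp, Function.update_self]
  rw [integral_const_mul, integral_aboveIndicator]

/-- The regret against buyers that buy if the value exceeds the price by `ε`, in terms of the
posted prices. -/
lemma sellerRegret_le_integral {L : ℝ≥0} (hL : LipschitzWith L (demand 𝒟)) {T : ℕ} (hT : 1 ≤ T)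
    {A : SellerPolicy} {B : BuyerPolicy Ξ} {ε pstar : ℝ} (hε0 : 0 ≤ ε) (hε : (L : ℝ) * ε = 1 / T)
    (hpstar : pstar ∈ Icc (0 : ℝ) 1)
    (hmax : ∀ p ∈ Icc (0 : ℝ) 1, revenue 𝒟 p ≤ revenue 𝒟 pstar)
    (hprice : ∀ (ω : Ξ × (ℕ → ℝ)) t, priceAt A B ω.1 ω.2 t ∈ Icc (0 : ℝ) 1)
    (hbuy : ∀ t < T, ∀ᵐ ω ∂(gameLaw ρ 𝒟), priceAt A B ω.1 ω.2 t + ε ≤ ω.2 t →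
      decisionAt A B ω.1 ω.2 t = true) :
    Integrable (fun ω : Ξ × (ℕ → ℝ) => ∑ t ∈ Finset.range T,
        (revenue 𝒟 pstar - revenue 𝒟 (priceAt A B ω.1 ω.2 t))) (gameLaw ρ 𝒟) ∧
    sellerRegret T ρ 𝒟 A B ≤ ∫ ω, ∑ t ∈ Finset.range T,
      (revenue 𝒟 pstar - revenue 𝒟 (priceAt A B ω.1 ω.2 t)) ∂(gameLaw ρ 𝒟) + 1 := by
  have hT' : (0 : ℝ) < T := by exact_mod_cast hT
  have hsup : sSup (revenue 𝒟 '' Icc (0 : ℝ) 1) = revenue 𝒟 pstar :=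
    IsGreatest.csSup_eq ⟨mem_image_of_mem _ hpstar, by rintro _ ⟨p, hp, rfl⟩; exact hmax p hp⟩
  have hdm : Measurable (demand 𝒟) := hL.continuous.measurable
  have hrm : Measurable (revenue 𝒟) := measurable_id.mul hdm
  have hrint (t : ℕ) : Integrable (fun ω : Ξ × (ℕ → ℝ) => revenue 𝒟 (priceAt A B ω.1 ω.2 t))
      (gameLaw ρ 𝒟) :=
    Integrable.of_mem_Icc 0 1 (hrm.comp (measurable_priceAt A B t)).aemeasurable
      (Eventually.of_forall fun ω => revenue_mem_Icc (hprice ω t))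
  have hdint (t : ℕ) : Integrable (fun ω : Ξ × (ℕ → ℝ) => priceAt A B ω.1 ω.2 t *
      demand 𝒟 (priceAt A B ω.1 ω.2 t + ε)) (gameLaw ρ 𝒟) := by
    refine Integrable.of_mem_Icc 0 1 ((measurable_priceAt A B t).mul
      (hdm.comp ((measurable_priceAt A B t).add_const ε))).aemeasurable
      (Eventually.of_forall fun ω => ?_)
    have h1 := hprice ω t
    have h2 := demand_mem_Icc (𝒟 := 𝒟) (priceAt A B ω.1 ω.2 t + ε)
    exact ⟨mul_nonneg h1.1 h2.1, mul_le_one₀ h1.2 h2.1 h2.2⟩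
  have haint (t : ℕ) : Integrable (fun ω : Ξ × (ℕ → ℝ) => priceAt A B ω.1 ω.2 t *
      purchase (decisionAt A B ω.1 ω.2 t)) (gameLaw ρ 𝒟) := by
    refine Integrable.of_mem_Icc 0 1 ((measurable_priceAt A B t).mul
      (measurable_purchase.comp (measurable_decisionAt A B t))).aemeasurable
      (Eventually.of_forall fun ω => ?_)
    have h1 := hprice ω t
    exact ⟨mul_nonneg h1.1 (purchase_nonneg _),
      mul_le_one₀ h1.2 (purchase_nonneg _) (purchase_le_one _)⟩
  have hgint (t : ℕ) : Integrable (fun ω : Ξ × (ℕ → ℝ) => revenue 𝒟 pstar -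
      revenue 𝒟 (priceAt A B ω.1 ω.2 t)) (gameLaw ρ 𝒟) := (integrable_const _).sub (hrint t)
  refine ⟨integrable_finsetSum _ fun t _ => hgint t, ?_⟩
  -- Buying only from `p + ε` on costs at most `p * L * ε ≤ 1 / T` per round, hence the extra `1` in
  -- total.
  have key (t : ℕ) (ht : t ∈ Finset.range T) :
      ∫ ω, revenue 𝒟 (priceAt A B ω.1 ω.2 t) ∂(gameLaw ρ 𝒟) - 1 / T ≤
        ∫ ω, priceAt A B ω.1 ω.2 t * purchase (decisionAt A B ω.1 ω.2 t) ∂(gameLaw ρ 𝒟) := by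
    obtain ⟨i1, i2⟩ := integral_price_mul_aboveIndicator (ρ := ρ) (𝒟 := 𝒟) A B
      (fun ω => hprice ω t) ε
    have e1 : ∫ ω, (revenue 𝒟 (priceAt A B ω.1 ω.2 t) - 1 / T) ∂(gameLaw ρ 𝒟) ≤
        ∫ ω, priceAt A B ω.1 ω.2 t * demand 𝒟 (priceAt A B ω.1 ω.2 t + ε) ∂(gameLaw ρ 𝒟) := by
      refine integral_mono ((hrint t).sub (integrable_const _)) (hdint t) fun ω => ?_
      have h1 := hprice ω t
      have h2 := hL.dist_le_mul (priceAt A B ω.1 ω.2 t) (priceAt A B ω.1 ω.2 t + ε)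
      rw [Real.dist_eq, Real.dist_eq, sub_add_cancel_left, abs_neg, abs_of_nonneg hε0, hε] at h2
      have h3 := (abs_le.1 h2).2
      have h4 : (0 : ℝ) < 1 / T := by positivity
      simp only [revenue]
      nlinarith [h1.1, h1.2, mul_le_mul_of_nonneg_left h3 h1.1]
    have e2 : ∫ ω, (revenue 𝒟 (priceAt A B ω.1 ω.2 t) - 1 / T) ∂(gameLaw ρ 𝒟) =
        ∫ ω, revenue 𝒟 (priceAt A B ω.1 ω.2 t) ∂(gameLaw ρ 𝒟) - 1 / T := by
      rw [integral_sub (hrint t) (integrable_const _)]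
      simp
    rw [← e2]
    refine e1.trans (i2.symm.le.trans (integral_mono_ae i1 (haint t) ?_))
    filter_upwards [hbuy t (Finset.mem_range.1 ht)] with ω hω
    refine mul_le_mul_of_nonneg_left ?_ (hprice ω t).1
    unfold aboveIndicator
    by_cases h : ω.2 t ∈ Ici (priceAt A B ω.1 ω.2 t + ε)
    · rw [hω h, indicator_of_mem h]
      simp [purchase]
    · rw [indicator_of_notMem h]
      exact purchase_nonneg _
  have hsum := Finset.sum_le_sum key
  rw [Finset.sum_sub_distrib, Finset.sum_const, Finset.card_range, nsmul_eq_mul,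
    mul_one_div_cancel hT'.ne'] at hsum
  rw [sellerRegret, hsup, integral_finsetSum _ fun t _ => haint t,
    integral_finsetSum _ fun t _ => hgint t]
  have hconst (t : ℕ) : ∫ ω, (revenue 𝒟 pstar - revenue 𝒟 (priceAt A B ω.1 ω.2 t))
      ∂(gameLaw ρ 𝒟) =
      revenue 𝒟 pstar - ∫ ω, revenue 𝒟 (priceAt A B ω.1 ω.2 t) ∂(gameLaw ρ 𝒟) := by
    rw [integral_sub (integrable_const _) (hrint t)]
    simp
  simp only [hconst]
  rw [Finset.sum_sub_distrib, Finset.sum_const, Finset.card_range, nsmul_eq_mul]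
  linarith

/-- An explicit bound on the regret of the elimination pricing policy. -/
theorem sellerRegret_eliminationPricing_le {L : ℝ≥0} (hv : ∀ᵐ v ∂𝒟, v ∈ Icc (0 : ℝ) 1)
    (hL : LipschitzWith L (demand 𝒟)) {pstar C₁ C₂ : ℝ} (hpstar : pstar ∈ Ioo (0 : ℝ) 1)
    (hgap : QuadraticGap 𝒟 pstar C₁ C₂) {T K D : ℕ} {γ ε δ : ℝ} (hT : 2 ≤ T) (hK : 1 ≤ K)
    (hD : 1 ≤ D) (h0 : 0 < γ) (h1 : γ < 1) (hε0 : 0 ≤ ε) (hε : (L : ℝ) * ε = 1 / T) (hδ : δ = 1 / T)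
    (hγ : γ ^ D / (1 - γ) ≤ ε) {B : BuyerPolicy Ξ}
    (hB : IsDiscountingBuyer γ T ρ 𝒟 (eliminationPricing K T D δ) B) :
    sellerRegret T ρ 𝒟 (eliminationPricing K T D δ) B ≤
      2 * C₂ * (T / (K : ℝ) ^ 2) + 16 + 3200 * ((K : ℝ) ^ 2 * Real.log T) * C₁⁻¹ +
        D * (1 + Real.log K) + 4 * K + T * (K * T * (2 * ((T : ℝ) ^ 4)⁻¹)) + 1 := by
  obtain ⟨hC₁, hC₂, hgap⟩ := hgap
  set A := eliminationPricing K T D δ with hA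
  set W := 2 * C₂ * (T / (K : ℝ) ^ 2) + 16 + 3200 * ((K : ℝ) ^ 2 * Real.log T) * C₁⁻¹ +
    D * (1 + Real.log K) + 4 * K with hW
  have hT' : (0 : ℝ) < T := by positivity
  have hδ0 : 0 ≤ δ := by rw [hδ]; positivity
  have hKlog : 0 ≤ Real.log K := Real.log_nonneg (by exact_mod_cast hK)
  have hTlog : 0 ≤ Real.log T := Real.log_natCast_nonneg T
  have hW0 : 0 ≤ W := by positivity
  have hmax (p : ℝ) (hp : p ∈ Icc (0 : ℝ) 1) : revenue 𝒟 p ≤ revenue 𝒟 pstar := by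
    have h := (hgap p hp).1
    have : 0 ≤ C₁ * (pstar - p) ^ 2 := by positivity
    linarith
  have hpricegrid (b : ℕ → Bool) (t : ℕ) : decisionPrice A b t ∈ Icc (0 : ℝ) 1 :=
    mem_Icc_of_mem_priceGrid (decisionPrice_mem_priceGrid T hK hD hδ0 b t)
  have hprice (ω : Ξ × (ℕ → ℝ)) (t : ℕ) : priceAt A B ω.1 ω.2 t ∈ Icc (0 : ℝ) 1 := by
    rw [priceAt_eq_decisionPrice]
    exact hpricegrid _ t
  have hmyopic (t : ℕ) (ht : t < T) := hB.ae_myopic h0 h1 hD hpricegrid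
    (fun b b' t s hb hs => decisionPrice_congr_of_delay K T hD hb hs) hγ hv ht
  obtain ⟨hint, hreg⟩ := sellerRegret_le_integral (ρ := ρ) hL (by omega) hε0 hε
    (Ioo_subset_Icc_self hpstar) hmax hprice fun t ht => (hmyopic t ht).mono fun ω h => h.1
  refine hreg.trans ?_
  obtain ⟨E, hEm, hE, hgood⟩ := exists_bad_event (ρ := ρ) (𝒟 := 𝒟) A B (priceGrid K)
    (by omega : 1 ≤ T) ε
  rw [card_priceGrid hK] at hE
  have hlip (x y : ℝ) (hxy : |x - y| = ε) : |demand 𝒟 x - demand 𝒟 y| ≤ δ := by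
    have := hL.dist_le_mul x y
    rwa [Real.dist_eq, Real.dist_eq, hxy, hε, ← hδ] at this
  -- Off `E` the deterministic bound `W` applies; on `E` the trivial bound `T` is affordable because
  -- `E` is rare.
  have hpoint : ∀ᵐ ω ∂(gameLaw ρ 𝒟), ∑ t ∈ Finset.range T,
      (revenue 𝒟 pstar - revenue 𝒟 (priceAt A B ω.1 ω.2 t)) ≤
        W + E.indicator (fun _ => (T : ℝ)) ω := by
    have hall : ∀ᵐ ω ∂(gameLaw ρ 𝒟), ∀ t, t < T →
        (priceAt A B ω.1 ω.2 t + ε ≤ ω.2 t → decisionAt A B ω.1 ω.2 t = true) ∧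
        (ω.2 t ≤ priceAt A B ω.1 ω.2 t - ε → decisionAt A B ω.1 ω.2 t = false) :=
      ae_all_iff.2 fun t => by
        by_cases ht : t < T
        · exact (hmyopic t ht).mono fun ω h _ => h
        · exact Eventually.of_forall fun ω h => absurd h ht
    filter_upwards [hall] with ω hω
    by_cases hωE : ω ∈ E
    · rw [indicator_of_mem hωE]
      have : ∑ t ∈ Finset.range T, (revenue 𝒟 pstar - revenue 𝒟 (priceAt A B ω.1 ω.2 t)) ≤
          T := by
        refine (Finset.sum_le_card_nsmul _ _ 1 fun t _ => ?_).trans (by simp)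
        have h1 := (revenue_mem_Icc (𝒟 := 𝒟) (Ioo_subset_Icc_self hpstar)).2
        have h2 := (revenue_mem_Icc (𝒟 := 𝒟) (hprice ω t)).1
        linarith
      linarith
    · rw [indicator_of_notMem hωE, add_zero]
      have hq (t : ℕ) : priceAt A B ω.1 ω.2 t =
          pulledArm (priceGrid K) T D δ (decisionReward (decisionAt A B ω.1 ω.2)) t := by
        rw [priceAt_eq_decisionPrice, hA, decisionPrice_eliminationPricing]
      have hconc := concentrated_of_sandwich (𝒟 := 𝒟) (ε := ε) hT hδ0
        (fun p hp => revenue_mem_Icc (mem_Icc_of_mem_priceGrid hp)) hq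
        (fun t ht => (hω t ht).1) (fun t ht => (hω t ht).2)
        (fun p => by
          have := (abs_le.1 (hlip (p - ε) p (by
            rw [sub_sub_cancel_left, abs_neg, abs_of_nonneg hε0]))).2
          linarith)
        (fun p => by
          have := (abs_le.1 (hlip (p + ε) p (by rw [add_sub_cancel_left, abs_of_nonneg hε0]))).1
          linarith)
        (fun p hp n hn => (hgood ω hωE p hp n hn).1) (fun p hp n hn => (hgood ω hωE p hp n hn).2)
      simp only [hq]
      exact hconc.sum_gap_le hK hT hD hδ hpstar hC₁ hC₂ hgap fun p hp => revenue_mem_Icc hp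
  have hindint : Integrable (E.indicator fun _ : Ξ × (ℕ → ℝ) => (T : ℝ)) (gameLaw ρ 𝒟) :=
    (integrable_const _).indicator hEm
  have hfinal := integral_mono_ae hint ((integrable_const W).add hindint) hpoint
  have hval : ∫ ω, (W + E.indicator (fun _ => (T : ℝ)) ω) ∂(gameLaw ρ 𝒟) =
      W + T * (gameLaw ρ 𝒟).real E := by
    rw [integral_add (integrable_const W) hindint, integral_indicator_const _ hEm]
    simp [mul_comm]
  have hET := mul_le_mul_of_nonneg_left hE hT'.le
  have := hfinal.trans hval.le
  linarith

end Regret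

end

/-! ### Assembly with the prescribed parameters -/

theorem mainTheorem8 :
    ∃ C : ℝ, 0 < C ∧
      ∀ (𝒟 : Measure ℝ) [IsProbabilityMeasure 𝒟] (L : ℝ≥0) (pstar : ℝ),
        (∀ᵐ v ∂𝒟, v ∈ Icc (0 : ℝ) 1) →
        LipschitzWith L (demand 𝒟) →
        pstar ∈ Ioo (0 : ℝ) 1 →
        (∀ p ∈ Icc (0 : ℝ) 1, p ≠ pstar → revenue 𝒟 p < revenue 𝒟 pstar) →
        (∀ᶠ p in 𝓝 pstar, DifferentiableAt ℝ (revenue 𝒟) p) →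
        deriv (deriv (revenue 𝒟)) pstar < 0 →
        (∃ C₁ C₂ : ℝ, QuadraticGap 𝒟 pstar C₁ C₂) ∧
        ∀ (C₁ C₂ : ℝ), QuadraticGap 𝒟 pstar C₁ C₂ →
        ∀ (T : ℕ) (γ Tγ ε δ : ℝ) (K D : ℕ),
          2 ≤ T → 0 < γ → γ < 1 →
          Tγ = 1 / (1 - γ) →
          ε = 1 / ((L : ℝ) * T) →
          δ = (L : ℝ) * ε →
          K = ⌈((T : ℝ) / Real.log T) ^ (1 / 4 : ℝ)⌉₊ →
          D = ⌈Tγ * Real.log ((L : ℝ) * Tγ * T)⌉₊ →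
          ∀ (Ξ : Type*) [MeasurableSpace Ξ] (ρ : Measure Ξ) [IsProbabilityMeasure ρ]
            (B : BuyerPolicy Ξ),
            IsDiscountingBuyer γ T ρ 𝒟 (eliminationPricing K T D δ) B →
            sellerRegret T ρ 𝒟 (eliminationPricing K T D δ) B ≤
              C * ((C₂ + C₁⁻¹) * Real.sqrt (T * Real.log T) +
                Tγ * Real.log ((L : ℝ) * Tγ * T) ^ 2) := by
  -- The coefficient of `C₁⁻¹ * s` dominates: `12800` from elimination, `32` from `4 * K`, and `25`
  -- from the additive constants.
  refine ⟨13000, by norm_num, fun 𝒟 _ L pstar hv hL hpstar hmax hdiff hd2 => ⟨?_, ?_⟩⟩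
  · have hcont : Continuous (revenue 𝒟) := continuous_id.mul hL.continuous
    exact exists_quadratic_gap hcont hpstar hmax hdiff hd2
  intro C₁ C₂ hgap T γ Tγ ε δ K D hT h0 h1 hTγ hε hδ hK hD Ξ _ ρ _ B hB
  have hL1 := one_le_of_lipschitz_demand hv hL
  have hT' : (2 : ℝ) ≤ T := by exact_mod_cast hT
  have hLε : (L : ℝ) * ε = 1 / T := by
    rw [hε]
    field_simp
  have hTγ1 : 1 ≤ Tγ := by
    rw [hTγ, one_le_div (by linarith)]
    linarith
  have hlogT : 1 / 2 ≤ Real.log T := by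
    have := Real.log_le_log (by norm_num) hT'
    linarith [Real.log_two_gt_d9]
  set ℓ := Real.log ((L : ℝ) * Tγ * T) with hℓ
  have hℓT : Real.log T ≤ ℓ := by
    refine Real.log_le_log (by linarith) (le_mul_of_one_le_left (by linarith) ?_)
    exact one_le_mul_of_one_le_of_one_le hL1 hTγ1
  have hTℓ : 1 / 2 ≤ Tγ * ℓ := by nlinarith
  have hD1 : 1 ≤ D := by
    rw [hD]
    exact Nat.ceil_pos.2 (by linarith)
  obtain ⟨hK1, hb1, hb2, hb3⟩ := gridSize_bounds hT hK
  have hK1' : (1 : ℝ) ≤ K := by exact_mod_cast hK1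
  have hγ : γ ^ D / (1 - γ) ≤ ε := by
    rw [hε]
    exact pow_delay_div_le h0 h1 (by linarith) (by omega) hTγ hD
  refine (sellerRegret_eliminationPricing_le hv hL hpstar hgap hT hK1 hD1 h0 h1
    (by rw [hε]; positivity) hLε (hδ.trans hLε) hγ hB).trans ?_
  obtain ⟨hC₁, hC₂, hgap⟩ := hgap
  have hC12 : C₁ ≤ C₂ := by
    obtain ⟨g1, g2⟩ := hgap 0 (by simp)
    refine le_of_mul_le_mul_right (g1.trans g2) ?_
    have := hpstar.1
    rw [sub_zero]
    positivity
  have hinv : 0 < C₁⁻¹ := inv_pos.2 hC₁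
  -- As `C₁ ≤ C₂`, either `C₂ ≥ 1` or `C₁⁻¹ ≥ 1`; this lets the leading term absorb quantities
  -- without problem constants.
  have hQ : 1 ≤ C₂ + C₁⁻¹ := by
    rcases le_total 1 C₂ with h | h
    · linarith
    · have := (one_le_inv₀ hC₁).2 (hC12.trans h)
      linarith
  set s := Real.sqrt (T * Real.log T) with hs
  have hs1 : 1 ≤ s := Real.one_le_sqrt.2 (by nlinarith)
  have hQs : s ≤ (C₂ + C₁⁻¹) * s := le_mul_of_one_le_left (by linarith) hQ
  -- The rounding in `D` costs `1 ≤ 2 * (Tγ * ℓ)`.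
  have hDle : (D : ℝ) ≤ 3 * (Tγ * ℓ) := by
    have := Nat.ceil_lt_add_one (by linarith : 0 ≤ Tγ * ℓ)
    rw [hD]
    linarith
  have hlogK : Real.log K ≤ 4 * ℓ := by
    have h2 : (K : ℝ) ≤ (T : ℝ) ^ 4 := by
      have : (8 : ℝ) ≤ (T : ℝ) ^ 3 := by
        have := pow_le_pow_left₀ (by norm_num) hT' 3
        norm_num at this
        linarith
      calc (K : ℝ) ≤ 8 * T := hb3
        _ ≤ (T : ℝ) ^ 3 * T := by gcongr
        _ = (T : ℝ) ^ 4 := by ring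
    have h3 := Real.log_le_log (by linarith) h2
    rw [Real.log_pow] at h3
    push_cast at h3
    linarith
  have t1 : 2 * C₂ * (T / (K : ℝ) ^ 2) ≤ 2 * (C₂ * s) := by
    rw [mul_assoc]
    gcongr
  have t2 : 3200 * ((K : ℝ) ^ 2 * Real.log T) * C₁⁻¹ ≤ 12800 * (C₁⁻¹ * s) := by
    have := mul_le_mul_of_nonneg_right hb2 hinv.le
    linarith
  have t3 : D * (1 + Real.log K) ≤ 18 * (Tγ * ℓ ^ 2) := by
    have h2 : 1 + Real.log K ≤ 6 * ℓ := by linarith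
    have h3 : 0 ≤ 1 + Real.log K := by linarith [Real.log_nonneg hK1']
    calc D * (1 + Real.log K) ≤ 3 * (Tγ * ℓ) * (6 * ℓ) := by gcongr
      _ = 18 * (Tγ * ℓ ^ 2) := by ring
  have t4 : 4 * (K : ℝ) ≤ 32 * s := by nlinarith
  have t5 : T * (K * T * (2 * ((T : ℝ) ^ 4)⁻¹)) ≤ 8 := by
    have h2 : T * (K * T * (2 * ((T : ℝ) ^ 4)⁻¹)) = 2 * K / (T : ℝ) ^ 2 := by
      field_simp
    rw [h2, div_le_iff₀ (by positivity)]
    nlinarith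
  have hC₂s : 0 ≤ C₂ * s := by positivity
  have hC₁s : 0 ≤ C₁⁻¹ * s := by positivity
  have hTℓ2 : 0 ≤ Tγ * ℓ ^ 2 := by positivity
  rw [add_mul] at hQs ⊢
  linarith
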